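/- Let $A$ and $V$ be finite-dimensional smooth manifolds and let $\mu:A\to V$ be a smooth principal bundle with structure group $(\mathbb R,+)$ and principal action $\psi:\mathbb R\times A\to A$; let $Z_\mu(a)=\frac{d}{ds}\big|_{s=0}\psi_s(a)$ be its infinitesimal generator. Let $\Omega$ be a symplectic form (a smooth, closed, nondegenerate $2$-form) on $A$ with $\psi_s^*\Omega=\Omega$ for all $s\in\mathbb R$ (that is, $\mu:(A,\Omega)\to V$ is a symplectic principal $\mathbb R$-bundle), and suppose $\dim A=2n+2$. Then for every $a\in A$ there exist smooth local coordinates $(t,p,q^i,p_i)$, $i=1,\dots,n$, on an open neighbourhood $U$ of $a$ in $A$ and smooth local coordinates $(t,q^i,p_i)$ on an open neighbourhood of $\mu(a)$ in $V$ containing $\mu(U)$ such that (i) in these coordinates $\mu$ is given by $\mu(t,p,q^i,p_i)=(t,q^i,p_i)$ on $U$; (ii) $(t,p,q^i,p_i)$ are Darboux coordinates for $\Omega$, i.e. $\Omega=dt\wedge dp+\sum_{i=1}^n dq^i\wedge dp_i$ on $U$. Moreover, $Z_\mu=\frac{\partial}{\partial p}$ on $U$. -/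

import Mathlib

open Set Module
open scoped Manifold ContDiff

namespace SymplecticRBundle

noncomputable section

section TwoForms

variable {E : Type*} [NormedAddCommGroup E] [NormedSpace ℝ E]
  {M : Type*} [TopologicalSpace M] [ChartedSpace E M]
  {F : Type*} [NormedAddCommGroup F] [NormedSpace ℝ F]
  {N : Type*} [TopologicalSpace N] [ChartedSpace F N]

variable (E M) in
/-- A (not necessarily smooth) differential 2-form on a manifold `M` modelled on `E`:
an alternating bilinear form on each tangent space. -/
abbrev TwoForm : Type _ :=
  ∀ a : M, (TangentSpace 𝓘(ℝ, E) a) [⋀^Fin 2]→L[ℝ] ℝ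

/-- The pullback `f^* Ω`, `(f^* Ω)_x (v, w) = Ω_{f x} (df_x v, df_x w)`. -/
def TwoForm.pullback (f : N → M) (Ω : TwoForm E M) : TwoForm F N := fun x =>
  (Ω (f x)).compContinuousLinearMap (mfderiv 𝓘(ℝ, F) 𝓘(ℝ, E) f x)

/-- The local representative of `Ω` in a chart `e`, a 2-form on `E`
(meaningful on `e.target` only): the pullback of `Ω` by `e⁻¹`. -/
def TwoForm.inChart (Ω : TwoForm E M) (e : OpenPartialHomeomorph M E) :
    E → E [⋀^Fin 2]→L[ℝ] ℝ :=
  Ω.pullback (F := E) (N := E) e.symm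

/-- `Ω` is smooth: its coefficients are smooth in every chart of the atlas. -/
def TwoForm.IsSmooth (Ω : TwoForm E M) : Prop :=
  ∀ e ∈ atlas E M, ContDiffOn ℝ ∞ (Ω.inChart e) e.target

/-- `dΩ = 0`: the exterior derivative vanishes in every chart of the atlas. -/
def TwoForm.IsClosed (Ω : TwoForm E M) : Prop :=
  ∀ e ∈ atlas E M, ∀ x ∈ e.target, extDeriv (Ω.inChart e) x = 0

/-- `Ω_a (v, ·) = 0` only for `v = 0`, at every point `a`. -/
def TwoForm.IsNondegenerate (Ω : TwoForm E M) : Prop :=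
  ∀ (a : M) (v : TangentSpace 𝓘(ℝ, E) a),
    (∀ w : TangentSpace 𝓘(ℝ, E) a, Ω a ![v, w] = 0) → v = 0

/-- A symplectic form: a smooth, closed, nondegenerate 2-form. -/
structure TwoForm.IsSymplectic (Ω : TwoForm E M) : Prop where
  smooth : Ω.IsSmooth
  closed : Ω.IsClosed
  nondegenerate : Ω.IsNondegenerate

/-- `φ` is a smooth local coordinate system on `M` with values in the normed space `F`:
a diffeomorphism from an open subset of `M` onto an open subset of `F`. -/
def IsSmoothCoordinateSystem (φ : OpenPartialHomeomorph M F) : Prop :=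
  ContMDiffOn 𝓘(ℝ, E) 𝓘(ℝ, F) ∞ φ φ.source ∧
    ContMDiffOn 𝓘(ℝ, F) 𝓘(ℝ, E) ∞ φ.symm φ.target

/-- The differential at `b` of a map `φ` from `M` to a normed space `F`
(for a coordinate system, the tuple of the differentials of the coordinate functions). -/
def differential (φ : M → F) (b : M) : TangentSpace 𝓘(ℝ, E) b →L[ℝ] F :=
  mfderiv 𝓘(ℝ, E) 𝓘(ℝ, F) φ b

end TwoForms

section Bundles

variable {E : Type*} [NormedAddCommGroup E] [NormedSpace ℝ E]
  {A : Type*} [TopologicalSpace A] [ChartedSpace E A]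
  {F : Type*} [NormedAddCommGroup F] [NormedSpace ℝ F]
  {V : Type*} [TopologicalSpace V] [ChartedSpace F V]
  {K : Type*} [NormedAddCommGroup K] [NormedSpace ℝ K]
  {G : Type*} [TopologicalSpace G] [ChartedSpace K G]

variable (E F K) in
/-- A local trivialization `μ⁻¹(U) ≅ U × G` of `μ : A → V` (`U` open in `V`, `G` a manifold
modelled on the normed space `K`) which is a diffeomorphism. -/
def IsSmoothTrivialization {μ : A → V} (T : Bundle.Trivialization G μ) : Prop :=
  ContMDiffOn 𝓘(ℝ, E) (𝓘(ℝ, F).prod 𝓘(ℝ, K)) ∞ T T.source ∧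
    ContMDiffOn (𝓘(ℝ, F).prod 𝓘(ℝ, K)) 𝓘(ℝ, E) ∞ T.toOpenPartialHomeomorph.symm T.target

variable (E F) in
/-- `μ : A → V` is a smooth principal bundle with structure group `(ℝ, +)` and principal
action `ψ`: `ψ` is a smooth action preserving the fibres of the smooth map `μ`, and over a
neighbourhood `U` of each point of `V` there is an equivariant diffeomorphism
`μ⁻¹(U) ≅ U × ℝ` over `U`, where `ℝ` acts on `U × ℝ` by translations of the second factor.
(A trivialization has source `μ⁻¹(U)` and target `U × ℝ`, so `μ` is onto.) -/
structure IsPrincipalRBundle (μ : A → V) (ψ : ℝ → A → A) : Prop where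
  zero_act : ∀ a, ψ 0 a = a
  add_act : ∀ s r a, ψ (s + r) a = ψ s (ψ r a)
  smooth_act : ContMDiff (𝓘(ℝ, ℝ).prod 𝓘(ℝ, E)) 𝓘(ℝ, E) ∞ (fun x : ℝ × A => ψ x.1 x.2)
  smooth_proj : ContMDiff 𝓘(ℝ, E) 𝓘(ℝ, F) ∞ μ
  proj_act : ∀ s a, μ (ψ s a) = μ a
  locally_trivial : ∀ v : V, ∃ T : Bundle.Trivialization ℝ μ,
    v ∈ T.baseSet ∧
    IsSmoothTrivialization E F ℝ T ∧
    ∀ a ∈ T.source, ∀ s : ℝ, T (ψ s a) = ((T a).1, s + (T a).2)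

variable (E) in
/-- The infinitesimal generator `Z_μ(a) = d/ds|_{s=0} ψ_s(a)` of the action `ψ`. -/
def infinitesimalGenerator (ψ : ℝ → A → A) (a : A) : TangentSpace 𝓘(ℝ, E) a :=
  mfderiv 𝓘(ℝ, ℝ) 𝓘(ℝ, E) (fun s : ℝ => ψ s a) 0 (1 : ℝ)

variable (F) in
/-- `μ : (A, Ω) → V` is a symplectic principal `ℝ`-bundle with principal action `ψ`:
`Ω` is symplectic and `ψ_s^* Ω = Ω` for all `s`. -/
structure IsSymplecticPrincipalRBundle (μ : A → V) (ψ : ℝ → A → A) (Ω : TwoForm E A) :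
    Prop where
  principal : IsPrincipalRBundle E F μ ψ
  symplectic : Ω.IsSymplectic
  invariant : ∀ s : ℝ, Ω.pullback (ψ s) = Ω

end Bundles

/-- The space of coordinates `(t, p, q, p_i)`. -/
abbrev TotalCoord (n : ℕ) : Type := ℝ × ℝ × (Fin n → ℝ) × (Fin n → ℝ)

/-- The space of coordinates `(t, q, p_i)`. -/
abbrev BaseCoord (n : ℕ) : Type := ℝ × (Fin n → ℝ) × (Fin n → ℝ)

/-- The projection `(t, p, q, p_i) ↦ (t, q, p_i)`. -/
def coordProj {n : ℕ} (x : TotalCoord n) : BaseCoord n := (x.1, x.2.2.1, x.2.2.2)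

/-- The value of `dt ∧ dp + ∑ i, dq^i ∧ dp_i` on two vectors,
with `(α ∧ β)(v, w) = α v * β w - β v * α w`. -/
def darbouxForm {n : ℕ} (v w : TotalCoord n) : ℝ :=
  (v.1 * w.2.1 - v.2.1 * w.1) +
    ∑ i, (v.2.2.1 i * w.2.2.2 i - v.2.2.2 i * w.2.2.1 i)

/-- The coordinate system `φ = (t, p, q, p_i)` is a Darboux coordinate system for `Ω`:
`Ω = dt ∧ dp + ∑ i, dq^i ∧ dp_i` on its domain. -/
def IsDarboux {E : Type*} [NormedAddCommGroup E] [NormedSpace ℝ E]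
    {A : Type*} [TopologicalSpace A] [ChartedSpace E A] {n : ℕ}
    (Ω : TwoForm E A) (φ : OpenPartialHomeomorph A (TotalCoord n)) : Prop :=
  ∀ b ∈ φ.source, ∀ v w : TangentSpace 𝓘(ℝ, E) b,
    Ω b ![v, w] = darbouxForm (differential φ b v) (differential φ b w)

end

end SymplecticRBundle

/-!
The proof is Moser's deformation argument, carried out equivariantly in a local trivialization.

Choose a trivialization of `μ` around `μ a` together with a chart of `V` centred at `μ a`
(`exists_isBundleChart`). This identifies a saturated neighbourhood of `a` with an open subset
`N × ℝ` of `F × ℝ`, where `F` is the model space of `V`, in such a way that `μ` is the projection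
to `N`, the action is by translations of `ℝ`, and `Z_μ` is the constant vector field `(0, 1)`.
In these coordinates `Ω` is translation-invariant, so it is given by a map `B` from `N` to the
bilinear forms on `F × ℝ`, and `dΩ = 0` is an identity between derivatives of `B` along `F`
(`IsClosedInvariantForm`).

The form `Ω - B 0` vanishes on the line `{0} × ℝ`, and the homotopy operator of the contraction
`(w, r) ↦ (t w, r)` produces a primitive `β` of it which is again translation-invariant and vanishes
to second order along that line (`exists_primitive`). The Moser field `X`, defined by
`i_X (B 0 + t (B - B 0)) = -β`, is therefore invariant as well, so its time-one map has the form
`(w, r) ↦ (ξ w, r + f w)`. It pulls `Ω` back to the constant form `B 0`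
(`exists_invariant_normal_form`), and being of this form it commutes with the projection and with
the translations. A linear isomorphism which is a Darboux basis for `B 0` and sends `(0, 1)` to
`∂/∂p` (`exists_linear_darboux`) then gives the coordinates `(t, p, q, p_i)`, and the quotient by
the `p`-direction gives `(t, q, p_i)`.

The one analytic input is the smooth dependence of the Moser flow on the initial point together
with the linearized equation (`exists_smooth_flow`). It follows from the inverse function theorem
in the Banach space of curves `C([0, 1], F × ℝ)`, applied to `γ ↦ γ - ∫ X (σ, γ σ) dσ`; as `X`
vanishes to second order at `0`, the derivative of this map at the constant curve `0` is the
identity. The map is smooth because superposition operators `γ ↦ g ∘ γ` with smooth `g` are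
smooth (`contDiffOn_superpose`). The same fact gives differentiation under the integral sign, which
is needed for the primitive `β`.
-/

namespace SymplecticRBundle

set_option linter.unusedSectionVars false

/-! ### Superposition operators on spaces of continuous curves -/

noncomputable section

section Superposition

variable {K : Type*} [TopologicalSpace K] [CompactSpace K]
  {E₁ : Type*} [NormedAddCommGroup E₁] [NormedSpace ℝ E₁]
  {E₂ : Type*} [NormedAddCommGroup E₂] [NormedSpace ℝ E₂]

open Classical in
/-- The superposition operator `γ ↦ g ∘ γ` on continuous maps, with the junk value `0` when
`g ∘ γ` is not continuous. -/
def superpose (g : E₁ → E₂) (γ : C(K, E₁)) : C(K, E₂) :=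
  if h : Continuous (g ∘ γ) then ⟨g ∘ γ, h⟩ else 0

/-- The continuous maps with values in `O`. -/
def curvesIn (K : Type*) [TopologicalSpace K] (O : Set E₁) : Set C(K, E₁) := {γ | ∀ t, γ t ∈ O}

lemma isOpen_curvesIn {O : Set E₁} (hO : IsOpen O) : IsOpen (curvesIn K O) := by
  have := ContinuousMap.isOpen_setOfPred_mapsTo (X := K) (Y := E₁) isCompact_univ hO
  simpa [curvesIn, MapsTo] using this

lemma superpose_apply {g : E₁ → E₂} {O : Set E₁} (hg : ContinuousOn g O) {γ : C(K, E₁)}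
    (hγ : γ ∈ curvesIn K O) (t : K) : superpose g γ t = g (γ t) := by
  have h : Continuous (g ∘ γ) := hg.comp_continuous γ.continuous hγ
  simp [superpose, h]

/-- Continuity of `h` on `O` is uniform around the compact image of a curve in `O`. -/
lemma exists_uniform_radius {O : Set E₁} (hO : IsOpen O) {h : E₁ → E₂} (hh : ContinuousOn h O)
    {γ : C(K, E₁)} (hγ : γ ∈ curvesIn K O) {ε : ℝ} (hε : 0 < ε) :
    ∃ δ > 0, ∀ t y, dist y (γ t) < δ → y ∈ O ∧ dist (h y) (h (γ t)) < ε := by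
  have hc : IsCompact (range γ) := isCompact_range γ.continuous
  have hs : range γ ⊆ O := range_subset_iff.2 hγ
  obtain ⟨δ₁, h₁, hδ₁⟩ := hc.exists_thickening_subset_open hO hs
  have := hc.uniformContinuousAt_of_continuousAt h
    (fun a ha ↦ hh.continuousAt (hO.mem_nhds (hs ha))) (Metric.dist_mem_uniformity hε)
  obtain ⟨δ₂, h₂, hδ₂⟩ := Metric.mem_uniformity_dist.1 this
  refine ⟨min δ₁ δ₂, lt_min h₁ h₂, fun t y hy ↦ ⟨hδ₁ ?_, ?_⟩⟩
  · exact Metric.mem_thickening_iff.2 ⟨γ t, mem_range_self t, hy.trans_le (min_le_left _ _)⟩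
  · have := hδ₂ (a := γ t) (b := y) (by rw [dist_comm]; exact hy.trans_le (min_le_right _ _))
      (mem_range_self t)
    rw [dist_comm]
    exact this

lemma continuousOn_superpose {O : Set E₁} (hO : IsOpen O) {g : E₁ → E₂} (hg : ContinuousOn g O) :
    ContinuousOn (superpose g) (curvesIn K O) := by
  intro γ hγ
  refine ContinuousAt.continuousWithinAt (Metric.continuousAt_iff.2 fun ε hε ↦ ?_)
  obtain ⟨δ, hδ, h⟩ := exists_uniform_radius hO hg hγ hε
  refine ⟨δ, hδ, fun {γ'} hd ↦ ?_⟩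
  have hd' : ∀ t, dist (γ' t) (γ t) < δ := (ContinuousMap.dist_lt_iff hδ).1 hd
  have hγ' : γ' ∈ curvesIn K O := fun t ↦ (h t _ (hd' t)).1
  refine (ContinuousMap.dist_lt_iff hε).2 fun t ↦ ?_
  rw [superpose_apply hg hγ, superpose_apply hg hγ']
  exact (h t _ (hd' t)).2

/-- Pointwise application `A, h ↦ (t ↦ A t (h t))`, as a continuous bilinear map. -/
def pointwiseApply : C(K, E₁ →L[ℝ] E₂) →L[ℝ] C(K, E₁) →L[ℝ] C(K, E₂) :=
  LinearMap.mkContinuous₂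
    (LinearMap.mk₂ ℝ (fun (A : C(K, E₁ →L[ℝ] E₂)) (h : C(K, E₁)) ↦
        (⟨fun t ↦ A t (h t), by fun_prop⟩ : C(K, E₂)))
      (fun _ _ _ ↦ by ext; simp) (fun _ _ _ ↦ by ext; simp) (fun _ _ _ ↦ by ext; simp)
      (fun _ _ _ ↦ by ext; simp)) 1
    (fun A h ↦ by
      refine (ContinuousMap.norm_le _ (by positivity)).2 fun t ↦ ?_
      rw [one_mul]
      exact ((A t).le_opNorm _).trans (mul_le_mul (A.norm_coe_le_norm t) (h.norm_coe_le_norm t)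
        (norm_nonneg (h t)) (norm_nonneg A)))

@[simp] lemma pointwiseApply_apply (A : C(K, E₁ →L[ℝ] E₂)) (h : C(K, E₁)) (t : K) :
    pointwiseApply A h t = A t (h t) := rfl

lemma hasFDerivAt_superpose {O : Set E₁} (hO : IsOpen O) {g : E₁ → E₂}
    (hg : ContDiffOn ℝ 1 g O) {γ : C(K, E₁)} (hγ : γ ∈ curvesIn K O) :
    HasFDerivAt (superpose g) (pointwiseApply (superpose (fderiv ℝ g) γ)) γ := by
  have hg' : ContinuousOn (fderiv ℝ g) O := hg.continuousOn_fderiv_of_isOpen hO le_rfl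
  have hd : DifferentiableOn ℝ g O := hg.differentiableOn one_ne_zero
  refine HasFDerivAt.of_isLittleO (Asymptotics.isLittleO_iff.2 fun ε hε ↦ ?_)
  obtain ⟨δ, hδ, h⟩ := exists_uniform_radius hO hg' hγ hε
  filter_upwards [Metric.ball_mem_nhds γ hδ] with γ' hγ'
  have hd' : ∀ t, dist (γ' t) (γ t) < δ := (ContinuousMap.dist_lt_iff hδ).1 hγ'
  have hγ'O : γ' ∈ curvesIn K O := fun t ↦ (h t _ (hd' t)).1
  refine (ContinuousMap.norm_le _ (by positivity)).2 fun t ↦ ?_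
  have := (convex_ball (γ t) δ).norm_image_sub_le_of_norm_fderiv_le' (𝕜 := ℝ) (f := g)
    (φ := fderiv ℝ g (γ t)) (C := ε)
    (fun y hy ↦ (hd y (h t y hy).1).differentiableAt (hO.mem_nhds (h t y hy).1))
    (fun y hy ↦ by rw [← dist_eq_norm]; exact (h t y hy).2.le)
    (Metric.mem_ball_self hδ) (hd' t)
  simp only [ContinuousMap.sub_apply, pointwiseApply_apply, superpose_apply hg.continuousOn hγ,
    superpose_apply hg.continuousOn hγ'O, superpose_apply hg' hγ]
  refine this.trans (mul_le_mul_of_nonneg_left ?_ hε.le)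
  exact (γ' - γ).norm_coe_le_norm t

end Superposition

section Smoothness

universe u

variable {K : Type*} [TopologicalSpace K] [CompactSpace K]
  {E₁ : Type u} [NormedAddCommGroup E₁] [NormedSpace ℝ E₁]

lemma contDiffOn_superpose_nat {O : Set E₁} (hO : IsOpen O) (k : ℕ) :
    ∀ {E₂ : Type u} [NormedAddCommGroup E₂] [NormedSpace ℝ E₂] {g : E₁ → E₂},
      ContDiffOn ℝ k g O → ContDiffOn ℝ k (superpose g) (curvesIn K O) := by
  induction k with
  | zero =>
    intro E₂ _ _ g hg
    exact contDiffOn_zero.2 (continuousOn_superpose hO hg.continuousOn)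
  | succ k ih =>
    intro E₂ _ _ g hg
    have hg1 : ContDiffOn ℝ 1 g O := hg.of_le (by norm_cast; omega)
    have hder := fun (γ : C(K, E₁)) (hγ : γ ∈ curvesIn K O) ↦ hasFDerivAt_superpose hO hg1 hγ
    push_cast at hg ⊢
    refine (contDiffOn_succ_iff_fderiv_of_isOpen (isOpen_curvesIn hO)).2
      ⟨fun γ hγ ↦ (hder γ hγ).differentiableAt.differentiableWithinAt, by simp, ?_⟩
    refine ContDiffOn.congr (f := fun γ ↦ pointwiseApply (superpose (fderiv ℝ g) γ)) ?_
      fun γ hγ ↦ (hder γ hγ).fderiv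
    exact (pointwiseApply (K := K) (E₁ := E₁) (E₂ := E₂)).contDiff.comp_contDiffOn
      (ih ((contDiffOn_succ_iff_fderiv_of_isOpen hO).1 hg).2.2)

/-- The superposition operator of a smooth map is smooth. Both spaces live in one universe since
the induction on the order of differentiability passes from `E₂` to `E₁ →L[ℝ] E₂`. -/
theorem contDiffOn_superpose {E₂ : Type u} [NormedAddCommGroup E₂] [NormedSpace ℝ E₂]
    {O : Set E₁} (hO : IsOpen O) {g : E₁ → E₂} (hg : ContDiffOn ℝ ∞ g O) :
    ContDiffOn ℝ ∞ (superpose g) (curvesIn K O) :=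
  contDiffOn_infty.2 fun k ↦ contDiffOn_superpose_nat hO k (contDiffOn_infty.1 hg k)

end Smoothness

/-! ### Primitives and smooth dependence of integrals on parameters -/

section Integration

open MeasureTheory

variable {E : Type*} [NormedAddCommGroup E] [NormedSpace ℝ E]

/-- The curve `γ`, extended to `ℝ` by constants. -/
abbrev extendCurve (γ : C(unitInterval, E)) : ℝ → E := IccExtend (zero_le_one' ℝ) γ

lemma continuous_extendCurve (γ : C(unitInterval, E)) : Continuous (extendCurve γ) :=
  γ.continuous.Icc_extend'

lemma extendCurve_coe (γ : C(unitInterval, E)) (t : unitInterval) : extendCurve γ t = γ t :=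
  IccExtend_val _ _ _

lemma norm_extendCurve_le (γ : C(unitInterval, E)) (t : ℝ) : ‖extendCurve γ t‖ ≤ ‖γ‖ :=
  γ.norm_coe_le_norm _

/-- The primitive `t ↦ ∫₀ᵗ γ` of a curve `γ` on `[0, 1]`, as a continuous linear operator. -/
def primitive : C(unitInterval, E) →L[ℝ] C(unitInterval, E) :=
  LinearMap.mkContinuous
    { toFun := fun γ ↦ ⟨fun t ↦ ∫ σ in (0 : ℝ)..t, extendCurve γ σ,
        (intervalIntegral.continuous_primitive
          (fun a b ↦ (continuous_extendCurve γ).intervalIntegrable a b) 0).comp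
          continuous_subtype_val⟩
      map_add' := fun γ₁ γ₂ ↦ by
        ext t
        exact intervalIntegral.integral_add
          ((continuous_extendCurve γ₁).intervalIntegrable _ _)
          ((continuous_extendCurve γ₂).intervalIntegrable _ _)
      map_smul' := fun c γ ↦ by
        ext t
        exact intervalIntegral.integral_smul c (extendCurve γ) }
    1 (fun γ ↦ by
      refine (ContinuousMap.norm_le _ (by positivity)).2 fun t ↦ ?_
      have := intervalIntegral.norm_integral_le_of_norm_le_const (a := (0 : ℝ)) (b := t)
        (f := extendCurve γ) (C := ‖γ‖) fun σ _ ↦ norm_extendCurve_le γ σ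
      rw [one_mul]
      refine this.trans (mul_le_of_le_one_right (norm_nonneg _) ?_)
      rw [sub_zero, abs_of_nonneg t.2.1]
      exact t.2.2)

lemma primitive_apply (γ : C(unitInterval, E)) (t : unitInterval) :
    primitive γ t = ∫ σ in (0 : ℝ)..t, extendCurve γ σ := rfl

lemma primitive_apply_zero (γ : C(unitInterval, E)) : primitive γ 0 = 0 := by
  simp [primitive_apply]

lemma hasDerivAt_integral_extendCurve [CompleteSpace E] (γ : C(unitInterval, E)) (t : ℝ) :
    HasDerivAt (fun t ↦ ∫ σ in (0 : ℝ)..t, extendCurve γ σ) (extendCurve γ t) t :=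
  intervalIntegral.integral_hasDerivAt_right
    ((continuous_extendCurve γ).intervalIntegrable _ _)
    ((continuous_extendCurve γ).stronglyMeasurableAtFilter _ _)
    (continuous_extendCurve γ).continuousAt

/-- The integral over `[0, 1]`, as a continuous linear operator on curves. -/
def integralOne : C(unitInterval, E) →L[ℝ] E :=
  (ContinuousMap.evalCLM ℝ (1 : unitInterval)).comp primitive

lemma integralOne_apply (γ : C(unitInterval, E)) : integralOne γ = ∫ σ in (0 : ℝ)..1, extendCurve γ σ :=
  rfl

/-- The fundamental theorem of calculus for curves on `[0, 1]`. -/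
lemma integralOne_eq_sub [CompleteSpace E] (γ : C(unitInterval, E)) (f : ℝ → E)
    (hf : ∀ t : unitInterval, HasDerivAt f (γ t) t) : integralOne γ = f 1 - f 0 := by
  rw [integralOne_apply]
  refine intervalIntegral.integral_eq_sub_of_hasDerivAt (fun t ht ↦ ?_)
    ((continuous_extendCurve γ).intervalIntegrable _ _)
  rw [uIcc_of_le zero_le_one] at ht
  have := hf ⟨t, ht⟩
  rwa [← extendCurve_coe] at this

lemma integralOne_comp {E' : Type*} [NormedAddCommGroup E'] [NormedSpace ℝ E'] [CompleteSpace E]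
    [CompleteSpace E'] (L : E →L[ℝ] E') (γ : C(unitInterval, E)) :
    L (integralOne γ) = integralOne ((L : C(E, E')).comp γ) := by
  rw [integralOne_apply, integralOne_apply,
    ← L.intervalIntegral_comp_comm ((continuous_extendCurve γ).intervalIntegrable _ _)]
  rfl

/-- The identity curve `t ↦ t` in `ℝ`, paired with the curve `γ`, as a map of `γ`. -/
def graph (γ : C(unitInterval, E)) : C(unitInterval, ℝ × E) := ⟨fun t ↦ (t, γ t), by fun_prop⟩

@[simp] lemma graph_apply (γ : C(unitInterval, E)) (t : unitInterval) : graph γ t = ((t : ℝ), γ t) := rfl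

/-- `h ↦ (0, h)`, the linear part of `graph`. -/
def graphLin : C(unitInterval, E) →L[ℝ] C(unitInterval, ℝ × E) :=
  (ContinuousLinearMap.inr ℝ ℝ E).compLeftContinuous ℝ unitInterval

@[simp] lemma graphLin_apply (γ : C(unitInterval, E)) (t : unitInterval) :
    graphLin γ t = ((0 : ℝ), γ t) := rfl

lemma graph_eq (γ : C(unitInterval, E)) : graph γ = graph 0 + graphLin γ := by
  ext t <;> simp

lemma contDiff_graph : ContDiff ℝ ∞ (graph : C(unitInterval, E) → C(unitInterval, ℝ × E)) := by
  rw [show (graph : C(unitInterval, E) → C(unitInterval, ℝ × E)) = fun γ ↦ graph 0 + graphLin γ from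
    funext graph_eq]
  exact contDiff_const.add (graphLin (E := E)).contDiff

lemma hasFDerivAt_graph (γ : C(unitInterval, E)) : HasFDerivAt graph (graphLin (E := E)) γ := by
  rw [show (graph : C(unitInterval, E) → C(unitInterval, ℝ × E)) = fun γ ↦ graph 0 + graphLin γ from
    funext graph_eq]
  exact (graphLin (E := E)).hasFDerivAt.const_add _

/-- Constant curves. -/
def constCurve : E →L[ℝ] C(unitInterval, E) :=
  LinearMap.mkContinuous
    { toFun := fun x ↦ ContinuousMap.const unitInterval x
      map_add' := fun _ _ ↦ rfl
      map_smul' := fun _ _ ↦ rfl } 1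
    (fun x ↦ (ContinuousMap.norm_le _ (by positivity)).2 fun t ↦ by
      rw [one_mul]; exact le_rfl)

@[simp] lemma constCurve_apply (x : E) (t : unitInterval) : constCurve x t = x := rfl

end Integration

section Parametric

universe u

variable {E E' : Type u} [NormedAddCommGroup E] [NormedSpace ℝ E]
  [NormedAddCommGroup E'] [NormedSpace ℝ E']

/-- The time-dependent superposition operator `γ ↦ (t ↦ g (t, γ t))`. -/
def timeSuperpose (g : ℝ × E → E') (γ : C(unitInterval, E)) : C(unitInterval, E') :=
  superpose g (graph γ)

variable {O : Set (ℝ × E)} {g : ℝ × E → E'}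

lemma isOpen_graph_preimage (hO : IsOpen O) :
    IsOpen {γ : C(unitInterval, E) | graph γ ∈ curvesIn unitInterval O} :=
  (isOpen_curvesIn hO).preimage (contDiff_graph (E := E)).continuous

lemma contDiffOn_timeSuperpose (hO : IsOpen O) (hg : ContDiffOn ℝ ∞ g O) :
    ContDiffOn ℝ ∞ (timeSuperpose g) {γ : C(unitInterval, E) | graph γ ∈ curvesIn unitInterval O} :=
  (contDiffOn_superpose hO hg).comp (contDiff_graph (E := E)).contDiffOn fun _ h ↦ h

lemma timeSuperpose_apply (hg : ContinuousOn g O) {γ : C(unitInterval, E)}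
    (hγ : graph γ ∈ curvesIn unitInterval O) (t : unitInterval) : timeSuperpose g γ t = g (t, γ t) :=
  superpose_apply hg hγ t

lemma hasFDerivAt_timeSuperpose (hO : IsOpen O) (hg : ContDiffOn ℝ ∞ g O) {γ : C(unitInterval, E)}
    (hγ : graph γ ∈ curvesIn unitInterval O) :
    HasFDerivAt (timeSuperpose g)
      ((pointwiseApply (timeSuperpose (fderiv ℝ g) γ)).comp graphLin) γ :=
  (hasFDerivAt_superpose hO (hg.of_le (by simp)) hγ).comp γ
    (hasFDerivAt_graph γ)

lemma fderiv_timeSuperpose_apply (hO : IsOpen O) (hg : ContDiffOn ℝ ∞ g O) {γ : C(unitInterval, E)}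
    (hγ : graph γ ∈ curvesIn unitInterval O) (h : C(unitInterval, E)) (t : unitInterval) :
    fderiv ℝ (timeSuperpose g) γ h t = fderiv ℝ g (t, γ t) (0, h t) := by
  rw [(hasFDerivAt_timeSuperpose hO hg hγ).fderiv]
  have : ContinuousOn (fderiv ℝ g) O :=
    hg.continuousOn_fderiv_of_isOpen hO (by simp)
  simp [timeSuperpose_apply this hγ]

/-- The integral `∫₀¹ g (t, x) dt` as a function of the parameter `x`. -/
def paramIntegral (g : ℝ × E → E') (x : E) : E' := integralOne (timeSuperpose g (constCurve x))

lemma contDiffOn_paramIntegral (hO : IsOpen O) (hg : ContDiffOn ℝ ∞ g O) {S : Set E}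
    (hS : ∀ x ∈ S, ∀ t : unitInterval, ((t : ℝ), x) ∈ O) : ContDiffOn ℝ ∞ (paramIntegral g) S :=
  (integralOne (E := E')).contDiff.comp_contDiffOn ((contDiffOn_timeSuperpose hO hg).comp
    (constCurve (E := E)).contDiff.contDiffOn fun x hx t ↦ hS x hx t)

/-- Differentiation under the integral sign. -/
lemma fderiv_paramIntegral (hO : IsOpen O) (hg : ContDiffOn ℝ ∞ g O) {x : E}
    (hx : ∀ t : unitInterval, ((t : ℝ), x) ∈ O) (a : E) : ∃ c : C(unitInterval, E'),
      (∀ t : unitInterval, c t = fderiv ℝ g (t, x) (0, a)) ∧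
        fderiv ℝ (paramIntegral g) x a = integralOne c := by
  have hγ : graph (constCurve x) ∈ curvesIn unitInterval O := fun t ↦ hx t
  have h := ((hasFDerivAt_timeSuperpose hO hg hγ).comp x (constCurve (E := E)).hasFDerivAt)
  have h' := (integralOne (E := E')).hasFDerivAt.comp x h
  refine ⟨fderiv ℝ (timeSuperpose g) (constCurve x) (constCurve a), fun t ↦ ?_, ?_⟩
  · rw [fderiv_timeSuperpose_apply hO hg hγ]
    simp
  · rw [show fderiv ℝ (paramIntegral g) x = _ from h'.fderiv,
      (hasFDerivAt_timeSuperpose hO hg hγ).fderiv]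
    rfl

end Parametric

end

/-! ### Local diffeomorphisms and flows depending smoothly on the initial condition -/

noncomputable section

/-- The inverse function theorem, with the smoothness of the inverse on its whole domain. -/
theorem exists_smooth_openPartialHomeomorph {E₁ E₂ : Type*} [NormedAddCommGroup E₁]
    [NormedSpace ℝ E₁] [CompleteSpace E₁] [NormedAddCommGroup E₂] [NormedSpace ℝ E₂]
    {U : Set E₁} (hU : IsOpen U) {f : E₁ → E₂} (hf : ContDiffOn ℝ ∞ f U) {a : E₁} (ha : a ∈ U)
    (f' : E₁ ≃L[ℝ] E₂) (hf' : HasFDerivAt f (f' : E₁ →L[ℝ] E₂) a) :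
    ∃ e : OpenPartialHomeomorph E₁ E₂, a ∈ e.source ∧ e.source ⊆ U ∧ (e : E₁ → E₂) = f ∧
      ContDiffOn ℝ ∞ e.symm e.target := by
  have hfa : ContDiffAt ℝ ∞ f a := hf.contDiffAt (hU.mem_nhds ha)
  let e₀ := hfa.toOpenPartialHomeomorph f hf' (by simp)
  let S : Set E₁ := U ∩ fderiv ℝ f ⁻¹' range ((↑) : (E₁ ≃L[ℝ] E₂) → E₁ →L[ℝ] E₂)
  have hS : IsOpen S := (hf.continuousOn_fderiv_of_isOpen hU (by simp)).isOpen_inter_preimage hU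
    ContinuousLinearEquiv.isOpen
  refine ⟨e₀.restrOpen S hS, ?_, fun x hx ↦ ?_, rfl, fun y hy ↦ ?_⟩
  · exact ⟨hfa.mem_toOpenPartialHomeomorph_source hf' (by simp), ha, f', hf'.fderiv.symm⟩
  · exact hx.2.1
  · obtain ⟨hU', e', he'⟩ := ((e₀.restrOpen S hS).map_target hy).2
    have hd := hf.contDiffAt (hU.mem_nhds hU')
    refine ((e₀.restrOpen S hS).contDiffAt_symm hy (f₀' := e') ?_ hd).contDiffWithinAt
    rw [he']
    exact (hd.differentiableAt (by simp)).hasFDerivAt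

universe u

variable {G : Type u} [NormedAddCommGroup G] [NormedSpace ℝ G] [CompleteSpace G]

/-- A time-dependent smooth vector field `f` vanishing to second order along `[0, 1] × {0}` has a
flow on `[0, 1] × W` for some neighbourhood `W` of `0`. The flow line `Γ x` of `x` depends smoothly
on `x`, and its derivative in `x` solves the linearized equation. This is the inverse function
theorem for `γ ↦ γ - ∫ f (σ, γ σ) dσ` on `C([0, 1], G)`, whose derivative at `0` is the
identity. -/
theorem exists_smooth_flow {O : Set (ℝ × G)} (hO : IsOpen O) {f : ℝ × G → G}
    (hf : ContDiffOn ℝ ∞ f O) (hO0 : ∀ t : unitInterval, ((t : ℝ), (0 : G)) ∈ O)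
    (hf0 : ∀ t : unitInterval, f (t, 0) = 0)
    (hdf0 : ∀ (t : unitInterval) (v : G), fderiv ℝ f (t, 0) (0, v) = 0) :
    ∃ (W : Set G) (Γ : G → C(unitInterval, G)), IsOpen W ∧ 0 ∈ W ∧ ContDiffOn ℝ ∞ Γ W ∧
      Γ 0 = 0 ∧ (∀ a, fderiv ℝ Γ 0 a = constCurve a) ∧
      ∀ x ∈ W, graph (Γ x) ∈ curvesIn unitInterval O ∧
        Γ x = constCurve x + primitive (timeSuperpose f (Γ x)) ∧
        ∀ a, fderiv ℝ Γ x a =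
          constCurve a + primitive (fderiv ℝ (timeSuperpose f) (Γ x) (fderiv ℝ Γ x a)) := by
  let U : Set C(unitInterval, G) := {γ | graph γ ∈ curvesIn unitInterval O}
  have hU : IsOpen U := isOpen_graph_preimage hO
  have h0U : (0 : C(unitInterval, G)) ∈ U := fun t ↦ hO0 t
  have hN : ContDiffOn ℝ ∞ (timeSuperpose f) U := contDiffOn_timeSuperpose hO hf
  let H : C(unitInterval, G) → C(unitInterval, G) := fun γ ↦ γ - primitive (timeSuperpose f γ)
  have hH : ContDiffOn ℝ ∞ H U :=
    contDiffOn_id.sub ((primitive (E := G)).contDiff.comp_contDiffOn hN)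
  have hNd : ∀ γ ∈ U, HasFDerivAt (timeSuperpose f) (fderiv ℝ (timeSuperpose f) γ) γ :=
    fun γ hγ ↦ ((hN.contDiffAt (hU.mem_nhds hγ)).differentiableAt (by simp)).hasFDerivAt
  have hHd : ∀ γ ∈ U, HasFDerivAt H
      (ContinuousLinearMap.id ℝ _ - primitive.comp (fderiv ℝ (timeSuperpose f) γ)) γ :=
    fun γ hγ ↦ (hasFDerivAt_id γ).sub ((primitive (E := G)).hasFDerivAt.comp γ (hNd γ hγ))
  have hN0 : fderiv ℝ (timeSuperpose f) (0 : C(unitInterval, G)) = 0 := by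
    ext h t
    rw [fderiv_timeSuperpose_apply hO hf h0U]
    exact hdf0 t (h t)
  have hH0 : HasFDerivAt H
      ((ContinuousLinearEquiv.refl ℝ C(unitInterval, G) :
        C(unitInterval, G) ≃L[ℝ] C(unitInterval, G)) :
        C(unitInterval, G) →L[ℝ] C(unitInterval, G)) 0 := by
    have := hHd 0 h0U
    rw [hN0, ContinuousLinearMap.comp_zero, sub_zero] at this
    exact this
  obtain ⟨e, he0, heU, heH, hes⟩ := exists_smooth_openPartialHomeomorph hU hH h0U _ hH0
  have hH00 : H 0 = 0 := by
    have : timeSuperpose f (0 : C(unitInterval, G)) = 0 := by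
      ext t
      rw [timeSuperpose_apply hf.continuousOn h0U]
      exact hf0 t
    simp [H, this]
  have hc0 : (constCurve (0 : G)) = 0 := map_zero _
  have h0t : (0 : C(unitInterval, G)) ∈ e.target := by
    have := e.map_source he0
    rwa [heH, hH00] at this
  have hs0 : e.symm 0 = 0 := by
    have := e.left_inv he0
    rwa [heH, hH00] at this
  let W : Set G := constCurve ⁻¹' e.target
  have hW : IsOpen W := e.open_target.preimage (constCurve (E := G)).continuous
  let Γ : G → C(unitInterval, G) := fun x ↦ e.symm (constCurve x)
  have hΓ : ContDiffOn ℝ ∞ Γ W :=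
    hes.comp (constCurve (E := G)).contDiff.contDiffOn fun x hx ↦ hx
  have hΓU : ∀ x ∈ W, Γ x ∈ U := fun x hx ↦ heU (e.map_target hx)
  have hΓH : ∀ x ∈ W, H (Γ x) = constCurve x := fun x hx ↦ by
    rw [← heH]
    exact e.right_inv hx
  have h0W : (0 : G) ∈ W := by
    change constCurve (0 : G) ∈ e.target
    rwa [hc0]
  have hΓ0 : Γ 0 = 0 := by
    change e.symm (constCurve (0 : G)) = 0
    rw [hc0, hs0]
  have hvar : ∀ x ∈ W, ∀ a, fderiv ℝ Γ x a =
      constCurve a + primitive (fderiv ℝ (timeSuperpose f) (Γ x) (fderiv ℝ Γ x a)) := by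
    intro x hx a
    have h1 : HasFDerivAt Γ (fderiv ℝ Γ x) x :=
      ((hΓ.contDiffAt (hW.mem_nhds hx)).differentiableAt (by simp)).hasFDerivAt
    have h2 := (hHd (Γ x) (hΓU x hx)).comp x h1
    have h3 : HasFDerivAt (H ∘ Γ) (constCurve (E := G)) x :=
      (constCurve (E := G)).hasFDerivAt.congr_of_eventuallyEq
        (Filter.eventually_of_mem (hW.mem_nhds hx) hΓH)
    have h4 := DFunLike.congr_fun (h2.unique h3) a
    simp only [ContinuousLinearMap.comp_apply, sub_apply,
      ContinuousLinearMap.id_apply] at h4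
    rw [← h4, sub_add_cancel]
  refine ⟨W, Γ, hW, h0W, hΓ, hΓ0, fun a ↦ ?_, fun x hx ↦ ⟨hΓU x hx, ?_, hvar x hx⟩⟩
  · rw [hvar 0 h0W a, hΓ0, hN0]
    simp
  · rw [← hΓH x hx]
    simp [H]

lemma hasDerivWithinAt_extendCurve {u k : C(unitInterval, G)} {c : G}
    (h : u = constCurve c + primitive k) (t : unitInterval) :
    HasDerivWithinAt (extendCurve u) (k t) (Icc 0 1) t := by
  have h1 := ((hasDerivAt_integral_extendCurve k t).const_add c).hasDerivWithinAt (s := Icc 0 1)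
  rw [extendCurve_coe] at h1
  refine h1.congr (fun s hs ↦ ?_) ?_
  · rw [show s = ((⟨s, hs⟩ : unitInterval) : ℝ) from rfl, extendCurve_coe, h]
    rfl
  · rw [extendCurve_coe, h]
    rfl

end

/-! ### Translation-invariant closed forms on `F × ℝ` -/

noncomputable section

universe u

variable {F : Type u} [NormedAddCommGroup F] [NormedSpace ℝ F] [FiniteDimensional ℝ F]

/-- `B` represents a closed 2-form on `s × ℝ ⊆ F × ℝ` which is invariant under translations of the
second factor: `B w` is its value at the points `(w, r)`. Only derivatives in directions of `F`
occur in its exterior derivative. -/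
structure IsClosedInvariantForm (B : F → (F × ℝ) →L[ℝ] (F × ℝ) →L[ℝ] ℝ) (s : Set F) : Prop where
  smooth : ContDiffOn ℝ ∞ B s
  alt : ∀ w ∈ s, ∀ v, B w v v = 0
  closed : ∀ w ∈ s, ∀ a b c : F × ℝ,
    fderiv ℝ B w a.1 b c - fderiv ℝ B w b.1 a c + fderiv ℝ B w c.1 a b = 0

variable {B : F → (F × ℝ) →L[ℝ] (F × ℝ) →L[ℝ] ℝ} {s : Set F}

namespace IsClosedInvariantForm

lemma mono (h : IsClosedInvariantForm B s) {s' : Set F} (hs : s' ⊆ s) :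
    IsClosedInvariantForm B s' :=
  ⟨h.smooth.mono hs, fun w hw ↦ h.alt w (hs hw), fun w hw ↦ h.closed w (hs hw)⟩

lemma skew (h : IsClosedInvariantForm B s) {w : F} (hw : w ∈ s) (a b : F × ℝ) :
    B w a b = -B w b a := by
  have h1 := h.alt w hw (a + b)
  simp only [map_add, add_apply, h.alt w hw a, h.alt w hw b] at h1
  linarith

end IsClosedInvariantForm

/-- The linear map `(a, r) ↦ (t a, r)` which contracts `F × ℝ` onto the line `{0} × ℝ`. -/
def contraction (F : Type u) [NormedAddCommGroup F] [NormedSpace ℝ F] (t : ℝ) :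
    (F × ℝ) →L[ℝ] (F × ℝ) :=
  (ContinuousLinearMap.inr ℝ F ℝ).comp (ContinuousLinearMap.snd ℝ F ℝ) +
    t • (ContinuousLinearMap.inl ℝ F ℝ).comp (ContinuousLinearMap.fst ℝ F ℝ)

@[simp] lemma contraction_apply (t : ℝ) (a : F × ℝ) : contraction F t a = (t • a.1, a.2) := by
  simp [contraction]

lemma contDiff_contraction : ContDiff ℝ ∞ (contraction F) :=
  contDiff_const.add (contDiff_id.smul contDiff_const)

section Affine

variable {E W : Type*} [NormedAddCommGroup E] [NormedSpace ℝ E]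
  [NormedAddCommGroup W] [NormedSpace ℝ W]

lemma hasFDerivAt_comp_smul_sub {b : E → W} {b' : E →L[ℝ] W} {t : ℝ} {w : E}
    (hb : HasFDerivAt b b' (t • w)) (c : W) :
    HasFDerivAt (fun x : E ↦ b (t • x) - c) (b'.comp (t • ContinuousLinearMap.id ℝ E)) w :=
  (HasFDerivAt.comp (f := fun x : E ↦ t • x) w hb ((hasFDerivAt_id w).const_smul t)).sub_const c

lemma contDiffOn_affinePath {b : E → W} {s : Set E} (hb : ContDiffOn ℝ ∞ b s) (c : W) :
    ContDiffOn ℝ ∞ (fun x : ℝ × (E × ℝ) ↦ c + x.1 • (b x.2.1 - c)) {x | x.2.1 ∈ s} := by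
  have h1 : ContDiff ℝ ∞ (fun x : ℝ × (E × ℝ) ↦ x.2.1) := contDiff_fst.comp contDiff_snd
  have h2 : ContDiffOn ℝ ∞ (fun x : ℝ × (E × ℝ) ↦ b x.2.1) {x | x.2.1 ∈ s} :=
    hb.comp h1.contDiffOn fun x hx ↦ hx
  exact contDiffOn_const.add (contDiff_fst.contDiffOn.smul (h2.sub contDiffOn_const))

lemma hasFDerivAt_affinePath {b : E → W} {b' : E →L[ℝ] W} {x : E × ℝ}
    (hb : HasFDerivAt b b' x.1) (t : ℝ) (c : W) :
    HasFDerivAt (fun y : E × ℝ ↦ c + t • (b y.1 - c))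
      (t • b'.comp (ContinuousLinearMap.fst ℝ E ℝ)) x :=
  (((HasFDerivAt.comp (f := Prod.fst) x hb hasFDerivAt_fst).sub_const c).const_smul
      t).const_add c

end Affine

/-- The integrand of the homotopy operator for the contraction onto `{0} × ℝ`, applied to
`B - B 0`. -/
def homotopyIntegrand (B : F → (F × ℝ) →L[ℝ] (F × ℝ) →L[ℝ] ℝ) (x : ℝ × F) : (F × ℝ) →L[ℝ] ℝ :=
  ((B (x.1 • x.2) - B 0) (x.2, 0)).comp (contraction F x.1)

lemma isOpen_smul_preimage_ball (r : ℝ) :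
    IsOpen {x : ℝ × F | x.1 • x.2 ∈ Metric.ball (0 : F) r} :=
  Metric.isOpen_ball.preimage (continuous_fst.smul continuous_snd)

lemma smul_mem_ball {r : ℝ} {w : F} (hw : w ∈ Metric.ball (0 : F) r) (t : unitInterval) :
    (t : ℝ) • w ∈ Metric.ball (0 : F) r := by
  rw [mem_ball_zero_iff] at hw ⊢
  rw [norm_smul, Real.norm_of_nonneg t.2.1]
  exact (mul_le_of_le_one_left (norm_nonneg _) t.2.2).trans_lt hw

lemma contDiffOn_homotopyIntegrand {r : ℝ} (hB : ContDiffOn ℝ ∞ B (Metric.ball 0 r)) :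
    ContDiffOn ℝ ∞ (homotopyIntegrand B) {x : ℝ × F | x.1 • x.2 ∈ Metric.ball (0 : F) r} := by
  have h1 : ContDiffOn ℝ ∞ (fun x : ℝ × F ↦ B (x.1 • x.2))
      {x : ℝ × F | x.1 • x.2 ∈ Metric.ball (0 : F) r} :=
    hB.comp (contDiff_fst.smul contDiff_snd).contDiffOn fun x hx ↦ hx
  have h2 : ContDiff ℝ ∞ (fun x : ℝ × F ↦ (x.2, (0 : ℝ))) := contDiff_snd.prodMk contDiff_const
  exact ((h1.sub contDiffOn_const).clm_apply h2.contDiffOn).clm_comp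
    ((contDiff_contraction (F := F)).comp contDiff_fst).contDiffOn

lemma fderiv_homotopyIntegrand {r : ℝ} (hB : ContDiffOn ℝ ∞ B (Metric.ball 0 r)) {t : ℝ} {w : F}
    (hw : t • w ∈ Metric.ball (0 : F) r) (a : F) (b : F × ℝ) :
    fderiv ℝ (homotopyIntegrand B) (t, w) (0, a) b =
      t * fderiv ℝ B (t • w) a (w, 0) (t • b.1, b.2) +
        (B (t • w) - B 0) (a, 0) (t • b.1, b.2) := by
  have hd : DifferentiableAt ℝ (homotopyIntegrand B) (t, w) :=
    ((contDiffOn_homotopyIntegrand hB).contDiffAt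
      ((isOpen_smul_preimage_ball r).mem_nhds hw)).differentiableAt (by simp)
  have h1 : HasFDerivAt (fun x : F ↦ homotopyIntegrand B (t, x) b)
      ((ContinuousLinearMap.apply ℝ ℝ b).comp ((fderiv ℝ (homotopyIntegrand B) (t, w)).comp
        (ContinuousLinearMap.inr ℝ ℝ F))) w :=
    (ContinuousLinearMap.apply ℝ ℝ b).hasFDerivAt.comp w
      (hd.hasFDerivAt.comp w (hasFDerivAt_prodMk_right t w))
  have hBd : HasFDerivAt B (fderiv ℝ B (t • w)) (t • w) :=
    ((hB.contDiffAt (Metric.isOpen_ball.mem_nhds hw)).differentiableAt (by simp)).hasFDerivAt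
  have h2 := hasFDerivAt_comp_smul_sub hBd (B 0)
  have h3 := (h2.clm_apply (ContinuousLinearMap.inl ℝ F ℝ).hasFDerivAt).clm_apply
    (hasFDerivAt_const (contraction F t b) w)
  have h4 := DFunLike.congr_fun (h1.unique h3) a
  rw [add_comm]
  simpa using h4

/-- The Poincaré lemma for invariant closed forms, relative to the constant form `B 0`: the
primitive `β` vanishes to second order at `0`. -/
theorem exists_primitive {r : ℝ} (hr : 0 < r) (h : IsClosedInvariantForm B (Metric.ball 0 r)) :
    ∃ β : F → (F × ℝ) →L[ℝ] ℝ, ContDiffOn ℝ ∞ β (Metric.ball 0 r) ∧ β 0 = 0 ∧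
      fderiv ℝ β 0 = 0 ∧ ∀ w ∈ Metric.ball (0 : F) r, ∀ a b : F × ℝ,
        fderiv ℝ β w a.1 b - fderiv ℝ β w b.1 a = B w a b - B 0 a b := by
  have hO := isOpen_smul_preimage_ball (F := F) r
  have hg := contDiffOn_homotopyIntegrand h.smooth
  have hmem : ∀ w ∈ Metric.ball (0 : F) r, ∀ t : unitInterval,
      ((t : ℝ), w) ∈ {x : ℝ × F | x.1 • x.2 ∈ Metric.ball (0 : F) r} :=
    fun w hw t ↦ smul_mem_ball hw t
  have h0 : (0 : F) ∈ Metric.ball (0 : F) r := Metric.mem_ball_self hr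
  refine ⟨paramIntegral (homotopyIntegrand B), contDiffOn_paramIntegral hO hg hmem, ?_, ?_, ?_⟩
  · have : timeSuperpose (homotopyIntegrand B) (constCurve (0 : F)) = 0 := by
      ext1 t
      rw [timeSuperpose_apply hg.continuousOn (γ := constCurve 0) (fun t ↦ hmem 0 h0 t)]
      simp [homotopyIntegrand]
    rw [paramIntegral, this, map_zero]
  · refine ContinuousLinearMap.ext fun a ↦ ?_
    obtain ⟨c, hc, hc'⟩ := fderiv_paramIntegral hO hg (hmem 0 h0) a
    have : c = 0 := by
      ext1 t
      refine ContinuousLinearMap.ext fun b ↦ ?_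
      rw [hc, fderiv_homotopyIntegrand h.smooth (hmem 0 h0 t)]
      have : (((0 : F), (0 : ℝ)) : F × ℝ) = 0 := rfl
      simp [this]
    rw [hc', this, map_zero]
    rfl
  · intro w hw a b
    obtain ⟨c, hc, hc'⟩ := fderiv_paramIntegral hO hg (hmem w hw) a.1
    obtain ⟨d, hd, hd'⟩ := fderiv_paramIntegral hO hg (hmem w hw) b.1
    rw [hc', hd', ← ContinuousLinearMap.apply_apply (𝕜 := ℝ) b (integralOne c),
      ← ContinuousLinearMap.apply_apply (𝕜 := ℝ) a (integralOne d), integralOne_comp,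
      integralOne_comp, ← map_sub]
    -- The integrand is the derivative of the pullback of `B - B 0` under the contraction.
    rw [integralOne_eq_sub _ (fun t ↦ (B (t • w) - B 0) (t • a.1, a.2) (t • b.1, b.2)) ?_]
    · simp
    · intro t
      have hBd : HasFDerivAt B (fderiv ℝ B ((t : ℝ) • w)) ((t : ℝ) • w) :=
        ((h.smooth.contDiffAt (Metric.isOpen_ball.mem_nhds
          (hmem w hw t))).differentiableAt (by simp)).hasFDerivAt
      have hsm : ∀ v : F, HasDerivAt (fun τ : ℝ ↦ τ • v) v (t : ℝ) := fun v ↦ by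
        simpa using (hasDerivAt_id (t : ℝ)).smul_const v
      have hpr : ∀ v : F × ℝ, HasDerivAt (fun τ : ℝ ↦ (τ • v.1, v.2)) (v.1, (0 : ℝ)) (t : ℝ) :=
        fun v ↦ (hsm v.1).prodMk (hasDerivAt_const _ _)
      have h1 := (((hBd.comp_hasDerivAt (t : ℝ) (hsm w)).sub_const (B 0)).clm_apply
        (hpr a)).clm_apply (hpr b)
      convert! h1 using 1
      -- Closedness on `(w, 0)` and the images of `a`, `b` trades the derivatives of `B` in the
      -- directions `a`, `b` for one along the ray.
      have hcl := h.closed _ (hmem w hw t) (w, 0) ((t : ℝ) • a.1, a.2) ((t : ℝ) • b.1, b.2)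
      have hsk := h.skew (hmem w hw t) ((t : ℝ) • a.1, a.2) (b.1, 0)
      have hsk0 := h.skew h0 ((t : ℝ) • a.1, a.2) (b.1, 0)
      simp only [ContinuousMap.sub_apply, ContinuousMap.comp_apply, ContinuousMap.coe_coe,
        ContinuousLinearMap.apply_apply, hc, hd, fderiv_homotopyIntegrand h.smooth (hmem w hw t),
        sub_apply, add_apply, map_smul, smul_apply, smul_eq_mul] at hcl ⊢
      simp only [Function.comp_apply]
      rw [hsk, hsk0]
      linarith

/-- The path of forms `B 0 + t (B w - B 0)` from the constant form `B 0` to `B`. -/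
def formPath (B : F → (F × ℝ) →L[ℝ] (F × ℝ) →L[ℝ] ℝ) (x : ℝ × F) :
    (F × ℝ) →L[ℝ] (F × ℝ) →L[ℝ] ℝ :=
  B 0 + x.1 • (B x.2 - B 0)

/-- Moser's vector field: the solution of `i_X (formPath B) = -β`. As a function of the point
of `F × ℝ` it depends on the first component only. -/
def moserField (B : F → (F × ℝ) →L[ℝ] (F × ℝ) →L[ℝ] ℝ) (β : F → (F × ℝ) →L[ℝ] ℝ)
    (x : ℝ × (F × ℝ)) : F × ℝ :=
  -(formPath B (x.1, x.2.1)).inverse (β x.2.1)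

/-- The domain of Moser's vector field: the points where the form of the path is nondegenerate. -/
def moserDomain (B : F → (F × ℝ) →L[ℝ] (F × ℝ) →L[ℝ] ℝ) (r : ℝ) : Set (ℝ × (F × ℝ)) :=
  {x | x.2.1 ∈ Metric.ball (0 : F) r ∧ (formPath B (x.1, x.2.1)).IsInvertible}

lemma contDiffOn_formPath {r : ℝ} (hB : ContDiffOn ℝ ∞ B (Metric.ball 0 r)) :
    ContDiffOn ℝ ∞ (fun x : ℝ × (F × ℝ) ↦ formPath B (x.1, x.2.1))
      {x | x.2.1 ∈ Metric.ball (0 : F) r} :=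
  contDiffOn_affinePath hB (B 0)

lemma isOpen_moserDomain {r : ℝ} (hB : ContDiffOn ℝ ∞ B (Metric.ball 0 r)) :
    IsOpen (moserDomain B r) := by
  have hU : IsOpen {x : ℝ × (F × ℝ) | x.2.1 ∈ Metric.ball (0 : F) r} :=
    Metric.isOpen_ball.preimage (continuous_fst.comp continuous_snd)
  have := (contDiffOn_formPath hB).continuousOn.isOpen_inter_preimage hU
    (ContinuousLinearEquiv.isOpen (𝕜 := ℝ) (E := F × ℝ) (F := (F × ℝ) →L[ℝ] ℝ))
  exact this

lemma contDiffOn_moserField {r : ℝ} (hB : ContDiffOn ℝ ∞ B (Metric.ball 0 r))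
    {β : F → (F × ℝ) →L[ℝ] ℝ} (hβ : ContDiffOn ℝ ∞ β (Metric.ball 0 r)) :
    ContDiffOn ℝ ∞ (moserField B β) (moserDomain B r) := by
  have h1 : ContDiff ℝ ∞ (fun x : ℝ × (F × ℝ) ↦ x.2.1) := contDiff_fst.comp contDiff_snd
  have h2 : ContDiffOn ℝ ∞ (fun x : ℝ × (F × ℝ) ↦ (formPath B (x.1, x.2.1)).inverse)
      (moserDomain B r) := fun x hx ↦
    ContDiffAt.comp_contDiffWithinAt (f := fun x : ℝ × (F × ℝ) ↦ formPath B (x.1, x.2.1)) x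
      (ContinuousLinearMap.IsInvertible.contDiffAt_map_inverse hx.2)
      ((contDiffOn_formPath hB x hx.1).mono fun y (hy : y ∈ moserDomain B r) ↦ hy.1)
  exact (h2.clm_apply (hβ.comp h1.contDiffOn fun x hx ↦ hx.1)).neg

lemma formPath_moserField {r : ℝ} {β : F → (F × ℝ) →L[ℝ] ℝ} {x : ℝ × (F × ℝ)}
    (hx : x ∈ moserDomain B r) :
    formPath B (x.1, x.2.1) (moserField B β x) = -β x.2.1 := by
  have := DFunLike.congr_fun (ContinuousLinearMap.IsInvertible.self_comp_inverse hx.2) (β x.2.1)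
  simp only [ContinuousLinearMap.comp_apply, ContinuousLinearMap.id_apply] at this
  rw [moserField, map_neg, this]

/-- The spatial derivative of the equation defining Moser's vector field. -/
lemma formPath_fderiv_moserField {r : ℝ} (hB : ContDiffOn ℝ ∞ B (Metric.ball 0 r))
    {β : F → (F × ℝ) →L[ℝ] ℝ} (hβ : ContDiffOn ℝ ∞ β (Metric.ball 0 r)) {t : ℝ} {x : F × ℝ}
    (hx : (t, x) ∈ moserDomain B r) (a b : F × ℝ) :
    formPath B (t, x.1) (fderiv ℝ (moserField B β) (t, x) (0, a)) b =
      -fderiv ℝ β x.1 a.1 b - t * fderiv ℝ B x.1 a.1 (moserField B β (t, x)) b := by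
  have hBd : HasFDerivAt B (fderiv ℝ B x.1) x.1 :=
    ((hB.contDiffAt (Metric.isOpen_ball.mem_nhds hx.1)).differentiableAt (by simp)).hasFDerivAt
  have hβd : HasFDerivAt β (fderiv ℝ β x.1) x.1 :=
    ((hβ.contDiffAt (Metric.isOpen_ball.mem_nhds hx.1)).differentiableAt (by simp)).hasFDerivAt
  have hXd : HasFDerivAt (moserField B β) (fderiv ℝ (moserField B β) (t, x)) (t, x) :=
    (((contDiffOn_moserField hB hβ).contDiffAt
      ((isOpen_moserDomain hB).mem_nhds hx)).differentiableAt (by simp)).hasFDerivAt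
  have h1 := hXd.comp x (hasFDerivAt_prodMk_right t x)
  have h2 : HasFDerivAt (fun y : F × ℝ ↦ formPath B (t, y.1))
      (t • (fderiv ℝ B x.1).comp (ContinuousLinearMap.fst ℝ F ℝ)) x :=
    hasFDerivAt_affinePath hBd t (B 0)
  have h3 := (h2.clm_apply h1).clm_apply (hasFDerivAt_const b x)
  have h4 : HasFDerivAt (fun y : F × ℝ ↦ (-β y.1) b)
      (-((ContinuousLinearMap.apply ℝ ℝ b).comp
        ((fderiv ℝ β x.1).comp (ContinuousLinearMap.fst ℝ F ℝ)))) x :=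
    ((ContinuousLinearMap.apply ℝ ℝ b).hasFDerivAt.comp x
      (HasFDerivAt.comp (f := Prod.fst) x hβd hasFDerivAt_fst)).neg
  have h5 : (fun y : F × ℝ ↦ (-β y.1) b) =ᶠ[nhds x]
      fun y ↦ formPath B (t, y.1) ((moserField B β ∘ Prod.mk t) y) b := by
    have : ∀ᶠ y in nhds x, (t, y) ∈ moserDomain B r :=
      ((isOpen_moserDomain hB).preimage (Continuous.prodMk_right t)).mem_nhds hx
    filter_upwards [this] with y hy
    rw [Function.comp_apply, formPath_moserField hy]
  have h6 := DFunLike.congr_fun ((h4.congr_of_eventuallyEq h5.symm).unique h3) a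
  simp at h6
  linarith

end

/-! ### Moser's argument -/

noncomputable section

universe u

variable {F : Type u} [NormedAddCommGroup F] [NormedSpace ℝ F] [FiniteDimensional ℝ F]
  {B : F → (F × ℝ) →L[ℝ] (F × ℝ) →L[ℝ] ℝ}

/-- A nondegenerate bilinear form on a finite-dimensional space is an isomorphism onto the
dual. -/
lemma isInvertible_of_nondegenerate {G : Type*} [NormedAddCommGroup G] [NormedSpace ℝ G]
    [FiniteDimensional ℝ G] {b : G →L[ℝ] G →L[ℝ] ℝ} (h : ∀ v, (∀ w, b v w = 0) → v = 0) :
    b.IsInvertible := by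
  have hinj : Function.Injective b := (injective_iff_map_eq_zero b).2 fun v hv ↦
    h v fun w ↦ by rw [hv]; rfl
  have hdim : finrank ℝ G = finrank ℝ (G →L[ℝ] ℝ) := by
    rw [← LinearEquiv.finrank_eq (LinearMap.toContinuousLinearMap (𝕜 := ℝ) (E := G) (F' := ℝ))]
    exact (Subspace.dual_finrank_eq (K := ℝ) (V := G)).symm
  let e : G ≃ₗ[ℝ] (G →L[ℝ] ℝ) :=
    LinearEquiv.ofInjectiveOfFinrankEq (b : G →ₗ[ℝ] (G →L[ℝ] ℝ)) hinj hdim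
  exact ⟨e.toContinuousLinearEquiv, by ext; rfl⟩

lemma hasDerivWithinAt_add_id_smul {W : Type*} [NormedAddCommGroup W] [NormedSpace ℝ W]
    {u : ℝ → W} {u' : W} {t : ℝ} {s : Set ℝ} (hu : HasDerivWithinAt u u' s t) (c : W) :
    HasDerivWithinAt (fun τ ↦ c + τ • u τ) (u t + t • u') s t := by
  simpa [add_comm] using ((hasDerivWithinAt_id t s).smul hu).const_add c

lemma formPath_zero_right (t : ℝ) : formPath B (t, 0) = B 0 := by
  ext <;> simp [formPath]

/-- Along a Moser flow line `γ`, with `p`, `q` two solutions of the linearized equation, the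
value of the form of the path on `(p, q)` is constant. -/
lemma formPath_flow_eq {r : ℝ} (h : IsClosedInvariantForm B (Metric.ball 0 r)) (hr : 0 < r)
    {β : F → (F × ℝ) →L[ℝ] ℝ} (hβ : ContDiffOn ℝ ∞ β (Metric.ball 0 r))
    (hdβ : ∀ w ∈ Metric.ball (0 : F) r, ∀ a b : F × ℝ,
      fderiv ℝ β w a.1 b - fderiv ℝ β w b.1 a = B w a b - B 0 a b)
    {γ p q : C(unitInterval, F × ℝ)} (hγO : graph γ ∈ curvesIn unitInterval (moserDomain B r))
    {x a b : F × ℝ}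
    (hγ : γ = constCurve x + primitive (timeSuperpose (moserField B β) γ))
    (hp : p = constCurve a + primitive (fderiv ℝ (timeSuperpose (moserField B β)) γ p))
    (hq : q = constCurve b + primitive (fderiv ℝ (timeSuperpose (moserField B β)) γ q)) :
    B (γ 1).1 (p 1) (q 1) = B 0 a b := by
  have hO := isOpen_moserDomain h.smooth
  have hX := contDiffOn_moserField h.smooth hβ
  have h0 : (0 : F) ∈ Metric.ball (0 : F) r := Metric.mem_ball_self hr
  let Q : ℝ → ℝ := fun t ↦
    formPath B (t, (extendCurve γ t).1) (extendCurve p t) (extendCurve q t)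
  have hQ : ∀ t ∈ Icc (0 : ℝ) 1, HasDerivWithinAt Q 0 (Icc 0 1) t := by
    intro t₀ ht₀
    obtain ⟨t, rfl⟩ : ∃ t : unitInterval, (t : ℝ) = t₀ := ⟨⟨t₀, ht₀⟩, rfl⟩
    have hmem : ((t : ℝ), γ t) ∈ moserDomain B r := hγO t
    have hball : (γ t).1 ∈ Metric.ball (0 : F) r := hmem.1
    have dγ := hasDerivWithinAt_extendCurve hγ t
    have dp := hasDerivWithinAt_extendCurve hp t
    have dq := hasDerivWithinAt_extendCurve hq t
    rw [timeSuperpose_apply hX.continuousOn hγO] at dγ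
    rw [fderiv_timeSuperpose_apply hO hX hγO] at dp dq
    have hBd : HasFDerivAt B (fderiv ℝ B (γ t).1) (extendCurve γ t).1 := by
      rw [extendCurve_coe]
      exact ((h.smooth.contDiffAt (Metric.isOpen_ball.mem_nhds hball)).differentiableAt
        (by simp)).hasFDerivAt
    have d1 : HasDerivWithinAt (fun s ↦ (extendCurve γ s).1)
        (moserField B β (t, γ t)).1 (Icc 0 1) t := dγ.fst
    have d2 := (hBd.comp_hasDerivWithinAt (t : ℝ) d1).sub_const (B 0)
    have d3 := hasDerivWithinAt_add_id_smul d2 (B 0)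
    have d4 := (d3.clm_apply dp).clm_apply dq
    refine d4.congr_deriv ?_
    have e1 := formPath_fderiv_moserField h.smooth hβ hmem (p t) (q t)
    have e2 := formPath_fderiv_moserField h.smooth hβ hmem (q t) (p t)
    have e3 := hdβ _ hball (p t) (q t)
    have e4 := h.closed _ hball (moserField B β (t, γ t)) (p t) (q t)
    have e5 := h.skew hball (p t) (fderiv ℝ (moserField B β) (t, γ t) (0, q t))
    have e6 := h.skew h0 (p t) (fderiv ℝ (moserField B β) (t, γ t) (0, q t))
    simp only [formPath, add_apply, sub_apply, smul_apply, smul_eq_mul] at e1 e2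
    simp only [Function.comp_apply, extendCurve_coe, add_apply, sub_apply, smul_apply,
      smul_eq_mul]
    rw [e5, e6]
    -- `e3` is `dβ = B - B 0`, and `e4` is closedness of `B` on the triple `(X, p, q)`.
    linear_combination e1 - e2 - e3 + (t : ℝ) * e4
  have hconst := constant_of_derivWithin_zero (f := Q) (a := 0) (b := 1)
    (fun t ht ↦ (hQ t ht).differentiableWithinAt)
    (fun t ht ↦ (hQ t (Ico_subset_Icc_self ht)).derivWithin
      (uniqueDiffOn_Icc zero_lt_one t (Ico_subset_Icc_self ht))) 1 (right_mem_Icc.2 zero_le_one)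
  have ex1 : ∀ c : C(unitInterval, F × ℝ), extendCurve c 1 = c 1 := fun c ↦ extendCurve_coe c 1
  have ex0 : ∀ c : C(unitInterval, F × ℝ), extendCurve c 0 = c 0 := fun c ↦ extendCurve_coe c 0
  have hp0 : p 0 = a := by rw [hp]; simp [primitive_apply_zero]
  have hq0 : q 0 = b := by rw [hq]; simp [primitive_apply_zero]
  simpa [Q, formPath, ex1, ex0, hp0, hq0] using hconst

/-- A closed invariant form on a neighbourhood of `{0} × ℝ` which is nondegenerate along
`{0} × ℝ` becomes constant after a coordinate change `(w, r) ↦ (ξ w, r + f w)`, which commutes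
with the translations of the second factor. -/
theorem exists_invariant_normal_form {N : Set F} (hN : N ∈ nhds 0)
    (h : IsClosedInvariantForm B N) (hnd : ∀ v, (∀ w, B 0 v w = 0) → v = 0) :
    ∃ (ξ : OpenPartialHomeomorph F F) (f : F → ℝ), 0 ∈ ξ.target ∧ ξ.target ⊆ N ∧
      ContDiffOn ℝ ∞ ξ ξ.source ∧ ContDiffOn ℝ ∞ ξ.symm ξ.target ∧ ContDiffOn ℝ ∞ f ξ.source ∧
      ∀ w ∈ ξ.source, ∀ a b : F × ℝ,
        B (ξ w) (fderiv ℝ ξ w a.1, a.2 + fderiv ℝ f w a.1)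
          (fderiv ℝ ξ w b.1, b.2 + fderiv ℝ f w b.1) = B 0 a b := by
  obtain ⟨r, hr, hrN⟩ := Metric.mem_nhds_iff.1 hN
  replace h := h.mono hrN
  obtain ⟨β, hβ, hβ0, hdβ0, hdβ⟩ := exists_primitive hr h
  have h0 : (0 : F) ∈ Metric.ball (0 : F) r := Metric.mem_ball_self hr
  have hO := isOpen_moserDomain h.smooth
  have hX := contDiffOn_moserField h.smooth hβ
  have hinv : (B 0).IsInvertible := isInvertible_of_nondegenerate hnd
  have hO0 : ∀ t : unitInterval, ((t : ℝ), (0 : F × ℝ)) ∈ moserDomain B r := fun t ↦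
    ⟨h0, by
      change (formPath B (t, 0)).IsInvertible
      rwa [formPath_zero_right]⟩
  have hX0 : ∀ t : unitInterval, moserField B β (t, 0) = 0 := fun t ↦ by
    simp [moserField, hβ0]
  have hdX0 : ∀ (t : unitInterval) (v : F × ℝ), fderiv ℝ (moserField B β) (t, 0) (0, v) = 0 := by
    intro t v
    refine hnd _ fun w ↦ ?_
    have := formPath_fderiv_moserField h.smooth hβ (hO0 t) v w
    simpa [formPath, hdβ0, hX0] using this
  obtain ⟨W, Γ, hW, h0W, hΓ, hΓ0, hdΓ0, hflow⟩ := exists_smooth_flow hO hX hO0 hX0 hdX0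
  let U : Set F := (fun w ↦ (w, (0 : ℝ))) ⁻¹' W
  have hU : IsOpen U := hW.preimage (Continuous.prodMk_left 0)
  have hΓd : ∀ w ∈ U, HasFDerivAt Γ (fderiv ℝ Γ (w, 0)) (w, 0) := fun w hw ↦
    ((hΓ.contDiffAt (hW.mem_nhds hw)).differentiableAt (by simp)).hasFDerivAt
  let ev : C(unitInterval, F × ℝ) →L[ℝ] F × ℝ := ContinuousMap.evalCLM ℝ (1 : unitInterval)
  let Φ : F → F × ℝ := fun w ↦ ev (Γ (w, 0))
  have hΦ : ContDiffOn ℝ ∞ Φ U := ev.contDiff.comp_contDiffOn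
    (hΓ.comp (contDiff_id.prodMk contDiff_const).contDiffOn fun w hw ↦ hw)
  have hΦd : ∀ w ∈ U, HasFDerivAt Φ
      (ev.comp ((fderiv ℝ Γ (w, 0)).comp (ContinuousLinearMap.inl ℝ F ℝ))) w := fun w hw ↦
    ev.hasFDerivAt.comp w ((hΓd w hw).comp w (hasFDerivAt_prodMk_left w 0))
  have hd0 : HasFDerivAt (fun w ↦ (Φ w).1)
      ((ContinuousLinearEquiv.refl ℝ F : F ≃L[ℝ] F) : F →L[ℝ] F) 0 := by
    refine (hΦd 0 h0W).fst.congr_fderiv ?_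
    ext a
    have := hdΓ0 (a, 0)
    have e : (((0 : F), (0 : ℝ)) : F × ℝ) = 0 := rfl
    simp [e, this, ev]
  obtain ⟨ξ, h0ξ, hξU, hξ, hξs⟩ := exists_smooth_openPartialHomeomorph hU hΦ.fst h0W _ hd0
  refine ⟨ξ, fun w ↦ (Φ w).2, ?_, ?_, ?_, hξs, hΦ.snd.mono hξU, ?_⟩
  · have := ξ.map_source h0ξ
    rw [hξ] at this
    have e : (((0 : F), (0 : ℝ)) : F × ℝ) = 0 := rfl
    simpa [Φ, e, hΓ0] using this
  · intro w hw
    have hw' := ξ.map_target hw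
    have := ((hflow _ (hξU hw')).1 1).1
    have e : ξ (ξ.symm w) = w := ξ.right_inv hw
    rw [hξ] at e
    rw [← e]
    exact hrN this
  · rw [hξ]
    exact hΦ.fst.mono hξU
  · intro w hw a b
    obtain ⟨hγO, hγ, hvar⟩ := hflow _ (hξU hw)
    have hj : ∀ c : F × ℝ, fderiv ℝ Γ (w, 0) (c.1, 0) + constCurve (0, c.2) =
        constCurve c + primitive (fderiv ℝ (timeSuperpose (moserField B β)) (Γ (w, 0))
          (fderiv ℝ Γ (w, 0) (c.1, 0) + constCurve (0, c.2))) := by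
      intro c
      -- The Moser field does not depend on the second component, so neither does its linearization.
      have hz : fderiv ℝ (timeSuperpose (moserField B β)) (Γ (w, 0)) (constCurve (0, c.2)) = 0 := by
        ext1 t
        rw [fderiv_timeSuperpose_apply hO hX hγO]
        refine (ContinuousLinearMap.IsInvertible.injective (hγO t).2) (?_)
        refine ContinuousLinearMap.ext fun v ↦ ?_
        have := formPath_fderiv_moserField h.smooth hβ (hγO t) (0, c.2) v
        simpa using this
      conv_lhs => rw [hvar (c.1, 0)]
      rw [map_add, hz, add_zero, add_right_comm, ← map_add]
      simp
    have := formPath_flow_eq h hr hβ hdβ hγO hγ (hj a) (hj b)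
    have hξd : ∀ c : F, fderiv ℝ ξ w c = (fderiv ℝ Γ (w, 0) (c, 0) 1).1 := fun c ↦ by
      rw [hξ, (hΦd w (hξU hw)).fst.fderiv]
      rfl
    have hfd : ∀ c : F, fderiv ℝ (fun w ↦ (Φ w).2) w c = (fderiv ℝ Γ (w, 0) (c, 0) 1).2 :=
      fun c ↦ by
        rw [(hΦd w (hξU hw)).snd.fderiv]
        rfl
    have hjv : ∀ c : F × ℝ, (fderiv ℝ Γ (w, 0) (c.1, 0) + constCurve (0, c.2) :
        C(unitInterval, F × ℝ)) 1 =
          (fderiv ℝ ξ w c.1, c.2 + fderiv ℝ (fun w ↦ (Φ w).2) w c.1) := fun c ↦ by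
      rw [hξd, hfd]
      ext
      · simp
      · simp [add_comm]
    rw [hjv, hjv] at this
    rw [← this, hξ]
    rfl

end

/-! ### Linear Darboux coordinates -/

noncomputable section

/-- Appending the coordinates of a symplectic plane to those of `TotalCoord n`. -/
def consCoord (n : ℕ) : (ℝ × ℝ × TotalCoord n) ≃ₗ[ℝ] TotalCoord (n + 1) where
  toFun x := (x.1, x.2.1, Fin.cons x.2.2.1 x.2.2.2.2.1, Fin.cons x.2.2.2.1 x.2.2.2.2.2)
  invFun y := (y.1, y.2.1, y.2.2.1 0, y.2.2.2 0, Fin.tail y.2.2.1, Fin.tail y.2.2.2)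
  map_add' x y := by
    refine Prod.ext rfl (Prod.ext rfl (Prod.ext ?_ ?_)) <;> funext i <;>
      refine Fin.cases ?_ (fun j ↦ ?_) i <;> simp
  map_smul' c x := by
    refine Prod.ext rfl (Prod.ext rfl (Prod.ext ?_ ?_)) <;> funext i <;>
      refine Fin.cases ?_ (fun j ↦ ?_) i <;> simp
  left_inv x := by simp
  right_inv y := by simp

lemma darbouxForm_consCoord {n : ℕ} (x y : ℝ × ℝ × TotalCoord n) :
    darbouxForm (consCoord n x) (consCoord n y) =
      (x.1 * y.2.1 - x.2.1 * y.1) + darbouxForm x.2.2 y.2.2 := by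
  simp [darbouxForm, consCoord, Fin.sum_univ_succ]
  ring

/-- A vector `Z ≠ 0` of a symplectic vector space lies in a symplectic plane, and the space is the
direct sum of that plane and its orthogonal complement `S`. -/
lemma exists_symplectic_splitting {X : Type*} [AddCommGroup X] [Module ℝ X]
    (b : X →ₗ[ℝ] X →ₗ[ℝ] ℝ) (halt : b.IsAlt) (hnd : ∀ v, (∀ w, b v w = 0) → v = 0)
    {Z : X} (hZ : Z ≠ 0) :
    ∃ (S : Submodule ℝ X) (e : X ≃ₗ[ℝ] ℝ × ℝ × S), e Z = (0, 1, 0) ∧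
      (∀ v w, b v w = ((e v).1 * (e w).2.1 - (e v).2.1 * (e w).1) + b (e v).2.2 (e w).2.2) ∧
      ∀ v : S, (∀ w : S, b v w = 0) → v = 0 := by
  obtain ⟨u₀, hu₀⟩ : ∃ u, b Z u ≠ 0 := by
    by_contra! hc
    exact hZ (hnd Z hc)
  obtain ⟨u, hu⟩ : ∃ u, b u Z = 1 := ⟨(-(b Z u₀)⁻¹) • u₀, by
    have := halt.neg Z u₀
    rw [map_smul, LinearMap.smul_apply, ← this, smul_eq_mul]
    field_simp⟩
  have hskew : ∀ v w, b v w = -b w v := fun v w ↦ (halt.neg w v).symm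
  have huu : b u u = 0 := halt u
  have hZZ : b Z Z = 0 := halt Z
  have hZu : b Z u = -1 := by rw [hskew, hu]
  let S : Submodule ℝ X := LinearMap.ker (b u) ⊓ LinearMap.ker (b Z)
  have hS : ∀ v : S, b u v = 0 ∧ b Z v = 0 := fun v ↦ v.2
  have hS' : ∀ v : S, b v u = 0 ∧ b v Z = 0 := fun v ↦ by
    rw [hskew _ u, hskew _ Z, (hS v).1, (hS v).2, neg_zero]
    exact ⟨rfl, rfl⟩
  let e : X ≃ₗ[ℝ] ℝ × ℝ × S :=
    { toFun := fun v ↦ (-b Z v, b u v, ⟨v + b Z v • u - b u v • Z, by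
        simp [S, huu, hu, hZu, hZZ]⟩)
      invFun := fun x ↦ x.1 • u + x.2.1 • Z + x.2.2
      map_add' := fun v w ↦ by
        refine Prod.ext (by simp; ring) (Prod.ext (by simp) (Subtype.ext ?_))
        simp only [map_add, add_smul, Prod.snd_add, Submodule.coe_add]
        abel
      map_smul' := fun c v ↦ by
        refine Prod.ext (by simp) (Prod.ext (by simp) (Subtype.ext ?_))
        simp [smul_sub, smul_add, mul_smul]
      left_inv := fun v ↦ by
        simp only [neg_smul]
        abel
      right_inv := fun x ↦ by
        have h1 := hS x.2.2
        refine Prod.ext ?_ (Prod.ext ?_ (Subtype.ext ?_))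
        · simp [h1.2, hZu, hZZ]
        · simp [h1.1, huu, hu]
        · simp only [map_add, map_smul, h1.1, h1.2, hZu, hZZ, huu, hu, smul_eq_mul]
          module }
  have he : ∀ v, v = (e v).1 • u + (e v).2.1 • Z + (e v).2.2 := fun v ↦ (e.symm_apply_apply v).symm
  refine ⟨S, e, ?_, fun v w ↦ ?_, fun v hv ↦ ?_⟩
  · refine Prod.ext ?_ (Prod.ext ?_ (Subtype.ext ?_))
    · change -b Z Z = 0
      rw [hZZ, neg_zero]
    · exact hu
    · change Z + b Z Z • u - b u Z • Z = 0
      simp [hZZ, hu]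
  · conv_lhs => rw [he v, he w]
    simp only [map_add, map_smul, LinearMap.add_apply, LinearMap.smul_apply, huu, hZZ, hu, hZu,
      (hS _).1, (hS _).2, (hS' _).1, (hS' _).2, smul_eq_mul]
    ring
  · refine Subtype.ext (hnd v fun w ↦ ?_)
    rw [he w, map_add, map_add, map_smul, map_smul, (hS' v).1, (hS' v).2, hv]
    simp

/-- A symplectic vector space of dimension `2n + 2` has linear Darboux coordinates in which a
given nonzero vector is the `p`-direction. -/
theorem exists_linear_darboux (n : ℕ) : ∀ {X : Type*} [AddCommGroup X] [Module ℝ X]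
    [FiniteDimensional ℝ X] (b : X →ₗ[ℝ] X →ₗ[ℝ] ℝ), b.IsAlt →
    (∀ v, (∀ w, b v w = 0) → v = 0) → finrank ℝ X = 2 * n + 2 → ∀ {Z : X}, Z ≠ 0 →
    ∃ L : X ≃ₗ[ℝ] TotalCoord n, L Z = (0, 1, 0, 0) ∧
      ∀ v w, b v w = darbouxForm (L v) (L w) := by
  induction n with
  | zero =>
    intro X _ _ _ b halt hnd hdim Z hZ
    obtain ⟨S, e, heZ, hb, -⟩ := exists_symplectic_splitting b halt hnd hZ
    have hS : finrank ℝ S = 0 := by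
      have := e.finrank_eq
      simp only [finrank_prod, finrank_self] at this
      omega
    have : Subsingleton S := finrank_zero_iff.1 hS
    let e' : S ≃ₗ[ℝ] (Fin 0 → ℝ) × (Fin 0 → ℝ) := 0
    refine ⟨e.trans ((LinearEquiv.refl ℝ ℝ).prodCongr ((LinearEquiv.refl ℝ ℝ).prodCongr e')),
      ?_, fun v w ↦ ?_⟩
    · simp only [LinearEquiv.trans_apply, heZ]
      rfl
    · rw [hb]
      simp [darbouxForm, Subsingleton.elim (e v).2.2 0]
  | succ n ih =>
    intro X _ _ _ b halt hnd hdim Z hZ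
    obtain ⟨S, e, heZ, hb, hSnd⟩ := exists_symplectic_splitting b halt hnd hZ
    have hS : finrank ℝ S = 2 * n + 2 := by
      have := e.finrank_eq
      simp only [finrank_prod, finrank_self] at this
      omega
    have : Nontrivial S := nontrivial_of_finrank_pos (R := ℝ) (by omega)
    obtain ⟨Z', hZ'⟩ := exists_ne (0 : S)
    obtain ⟨L, -, hL⟩ := ih (b.domRestrict₁₂ S S) (fun v ↦ halt v) hSnd hS hZ'
    refine ⟨(e.trans ((LinearEquiv.refl ℝ ℝ).prodCongr ((LinearEquiv.refl ℝ ℝ).prodCongr L))).trans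
      (consCoord n), ?_, fun v w ↦ ?_⟩
    · simp only [LinearEquiv.trans_apply, heZ]
      refine Prod.ext rfl (Prod.ext rfl (Prod.ext ?_ ?_)) <;> funext i <;>
      refine Fin.cases ?_ (fun j ↦ ?_) i <;> simp [consCoord]
    · rw [hb]
      simp only [LinearEquiv.trans_apply, darbouxForm_consCoord]
      have := hL (e v).2.2 (e w).2.2
      simp only [LinearMap.domRestrict₁₂_apply] at this
      rw [this]
      rfl

end

/-! ### Adapted Darboux coordinates for an invariant form on `F × ℝ` -/

noncomputable section

section Shear

variable {F : Type*} [NormedAddCommGroup F] [NormedSpace ℝ F]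

/-- The coordinate change `(w, r) ↦ (ξ w, r + f w)`. -/
def shear (ξ : OpenPartialHomeomorph F F) (f : F → ℝ) (hf : ContinuousOn f ξ.source) :
    OpenPartialHomeomorph (F × ℝ) (F × ℝ) where
  toFun x := (ξ x.1, x.2 + f x.1)
  invFun y := (ξ.symm y.1, y.2 - f (ξ.symm y.1))
  source := Prod.fst ⁻¹' ξ.source
  target := Prod.fst ⁻¹' ξ.target
  map_source' _ hx := ξ.map_source hx
  map_target' _ hy := ξ.map_target hy
  left_inv' x hx := by simp [ξ.left_inv (show x.1 ∈ ξ.source from hx)]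
  right_inv' y hy := by simp [ξ.right_inv (show y.1 ∈ ξ.target from hy)]
  open_source := ξ.open_source.preimage continuous_fst
  open_target := ξ.open_target.preimage continuous_fst
  continuousOn_toFun := (ξ.continuousOn.comp continuousOn_fst fun _ h ↦ h).prodMk
    (continuousOn_snd.add (hf.comp continuousOn_fst fun _ h ↦ h))
  continuousOn_invFun := by
    have h : ContinuousOn (fun y : F × ℝ ↦ ξ.symm y.1) (Prod.fst ⁻¹' ξ.target) :=
      ξ.continuousOn_symm.comp continuousOn_fst fun _ h ↦ h
    exact h.prodMk (continuousOn_snd.sub (hf.comp h fun y hy ↦ ξ.map_target hy))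

variable {ξ : OpenPartialHomeomorph F F} {f : F → ℝ} {hf : ContinuousOn f ξ.source}

lemma contDiffOn_shear (hξ : ContDiffOn ℝ ∞ ξ ξ.source) (hf' : ContDiffOn ℝ ∞ f ξ.source) :
    ContDiffOn ℝ ∞ (shear ξ f hf) (shear ξ f hf).source :=
  (hξ.comp contDiffOn_fst fun _ h ↦ h).prodMk
    (contDiffOn_snd.add (hf'.comp contDiffOn_fst fun _ h ↦ h))

lemma contDiffOn_shear_symm (hξ : ContDiffOn ℝ ∞ ξ.symm ξ.target)
    (hf' : ContDiffOn ℝ ∞ f ξ.source) :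
    ContDiffOn ℝ ∞ (shear ξ f hf).symm (shear ξ f hf).target := by
  have h : ContDiffOn ℝ ∞ (fun y : F × ℝ ↦ ξ.symm y.1) (Prod.fst ⁻¹' ξ.target) :=
    hξ.comp contDiffOn_fst fun _ h ↦ h
  exact h.prodMk (contDiffOn_snd.sub (hf'.comp h fun y hy ↦ ξ.map_target hy))

lemma fderiv_shear (hξ : ContDiffOn ℝ ∞ ξ ξ.source) (hf' : ContDiffOn ℝ ∞ f ξ.source)
    {x : F × ℝ} (hx : x.1 ∈ ξ.source) (a : F × ℝ) :
    fderiv ℝ (shear ξ f hf) x a = (fderiv ℝ ξ x.1 a.1, a.2 + fderiv ℝ f x.1 a.1) := by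
  have h1 : HasFDerivAt ξ (fderiv ℝ ξ x.1) x.1 :=
    ((hξ.contDiffAt (ξ.open_source.mem_nhds hx)).differentiableAt (by simp)).hasFDerivAt
  have h2 : HasFDerivAt f (fderiv ℝ f x.1) x.1 :=
    ((hf'.contDiffAt (ξ.open_source.mem_nhds hx)).differentiableAt (by simp)).hasFDerivAt
  have h3 : HasFDerivAt (shear ξ f hf) _ x :=
    (h1.comp x hasFDerivAt_fst).prodMk (hasFDerivAt_snd.add (h2.comp x hasFDerivAt_fst))
  rw [h3.fderiv]
  rfl

end Shear

/-- The derivatives of mutually inverse smooth coordinate changes are mutually inverse. -/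
lemma fderiv_symm_comp_fderiv {E₁ E₂ : Type*} [NormedAddCommGroup E₁] [NormedSpace ℝ E₁]
    [NormedAddCommGroup E₂] [NormedSpace ℝ E₂] {e : OpenPartialHomeomorph E₁ E₂}
    (he : ContDiffOn ℝ ∞ e e.source) (hes : ContDiffOn ℝ ∞ e.symm e.target) {x : E₁}
    (hx : x ∈ e.source) (v : E₁) : fderiv ℝ e.symm (e x) (fderiv ℝ e x v) = v := by
  have h1 := ((he.contDiffAt (e.open_source.mem_nhds hx)).differentiableAt (by simp)).hasFDerivAt
  have h2 := ((hes.contDiffAt (e.open_target.mem_nhds (e.map_source hx))).differentiableAt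
    (by simp)).hasFDerivAt
  have h3 : HasFDerivAt (e.symm ∘ e) (ContinuousLinearMap.id ℝ E₁) x :=
    (hasFDerivAt_id x).congr_of_eventuallyEq
      (Filter.eventually_of_mem (e.open_source.mem_nhds hx) fun y hy ↦ e.left_inv hy)
  exact DFunLike.congr_fun ((h2.comp x h1).unique h3) v

section Quotient

variable {F : Type*} [NormedAddCommGroup F] [NormedSpace ℝ F] [FiniteDimensional ℝ F] {n : ℕ}

lemma coordProj_of_line (L : (F × ℝ) ≃L[ℝ] TotalCoord n) (hL : L (0, 1) = (0, 1, 0, 0))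
    (x : F × ℝ) : coordProj (L x) = coordProj (L (x.1, 0)) := by
  have h : x = (x.1, 0) + x.2 • ((0 : F), (1 : ℝ)) := by ext <;> simp
  conv_lhs => rw [h, map_add, map_smul, hL]
  simp [coordProj]

/-- The isomorphism `F ≃ BaseCoord n` induced on the quotients by `{0} × ℝ` and by the `p`-axis. -/
def quotientEquiv (L : (F × ℝ) ≃L[ℝ] TotalCoord n) (hL : L (0, 1) = (0, 1, 0, 0)) :
    F ≃L[ℝ] BaseCoord n :=
  LinearEquiv.toContinuousLinearEquiv
    { toFun := fun w ↦ coordProj (L (w, 0))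
      invFun := fun z ↦ (L.symm (z.1, 0, z.2.1, z.2.2)).1
      map_add' := fun v w ↦ by
        rw [show ((v + w, 0) : F × ℝ) = (v, 0) + (w, 0) by simp, map_add]
        rfl
      map_smul' := fun c v ↦ by
        rw [show ((c • v, 0) : F × ℝ) = c • (v, 0) by simp, map_smul]
        rfl
      left_inv := fun w ↦ by
        have h : (((L (w, 0)).1, 0, (L (w, 0)).2.2.1, (L (w, 0)).2.2.2) : TotalCoord n) =
            L (w, 0) - (L (w, 0)).2.1 • L (0, 1) := by
          rw [hL]
          ext <;> simp
        change (L.symm ((L (w, 0)).1, 0, (L (w, 0)).2.2.1, (L (w, 0)).2.2.2)).1 = w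
        rw [h, ← map_smul, ← map_sub, L.symm_apply_apply]
        simp
      right_inv := fun z ↦ by
        change coordProj (L ((L.symm (z.1, 0, z.2.1, z.2.2)).1, 0)) = z
        rw [← coordProj_of_line L hL, L.apply_symm_apply]
        rfl }

lemma quotientEquiv_apply (L : (F × ℝ) ≃L[ℝ] TotalCoord n) (hL : L (0, 1) = (0, 1, 0, 0))
    (x : F × ℝ) : quotientEquiv L hL x.1 = coordProj (L x) :=
  (coordProj_of_line L hL x).symm

end Quotient

universe u

variable {F : Type u} [NormedAddCommGroup F] [NormedSpace ℝ F] [FiniteDimensional ℝ F]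
  {B : F → (F × ℝ) →L[ℝ] (F × ℝ) →L[ℝ] ℝ}

/-- Darboux coordinates `g` for an invariant closed form on a neighbourhood of `{0} × ℝ` in
`F × ℝ`, which cover coordinates `χ` on `F` and send the second direction to `∂/∂p`. -/
theorem exists_adapted_darboux {N : Set F} (hN : N ∈ nhds 0) (h : IsClosedInvariantForm B N)
    (hnd : ∀ v, (∀ w, B 0 v w = 0) → v = 0) {n : ℕ} (hdim : finrank ℝ (F × ℝ) = 2 * n + 2) :
    ∃ (g : OpenPartialHomeomorph (F × ℝ) (TotalCoord n)) (χ : OpenPartialHomeomorph F (BaseCoord n)),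
      ContDiffOn ℝ ∞ g g.source ∧ ContDiffOn ℝ ∞ g.symm g.target ∧
      ContDiffOn ℝ ∞ χ χ.source ∧ ContDiffOn ℝ ∞ χ.symm χ.target ∧
      0 ∈ χ.source ∧ χ.source ⊆ N ∧ (∀ x, x ∈ g.source ↔ x.1 ∈ χ.source) ∧
      ∀ x ∈ g.source, χ x.1 = coordProj (g x) ∧ fderiv ℝ g x (0, 1) = (0, 1, 0, 0) ∧
        ∀ a b, B x.1 a b = darbouxForm (fderiv ℝ g x a) (fderiv ℝ g x b) := by
  obtain ⟨ξ, f, h0, hξN, hξ, hξs, hf, hB⟩ := exists_invariant_normal_form hN h hnd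
  have h0N : (0 : F) ∈ N := mem_of_mem_nhds hN
  have hZ : ((0 : F), (1 : ℝ)) ≠ 0 := by simp
  obtain ⟨L₀, hL₀, hL₀B⟩ := exists_linear_darboux n
    ((ContinuousLinearMap.coeLM ℝ).comp (B 0 : (F × ℝ) →ₗ[ℝ] (F × ℝ) →L[ℝ] ℝ))
    (fun v ↦ h.alt 0 h0N v) hnd hdim hZ
  let L : (F × ℝ) ≃L[ℝ] TotalCoord n := L₀.toContinuousLinearEquiv
  have hL : L (0, 1) = (0, 1, 0, 0) := hL₀
  have hLB : ∀ v w, B 0 v w = darbouxForm (L v) (L w) := hL₀B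
  let Ξ := shear ξ f hf.continuousOn
  have hΞ : ContDiffOn ℝ ∞ Ξ Ξ.source := contDiffOn_shear hξ hf
  have hΞs : ContDiffOn ℝ ∞ Ξ.symm Ξ.target := contDiffOn_shear_symm hξs hf
  refine ⟨Ξ.symm.transHomeomorph L.toHomeomorph,
    ξ.symm.transHomeomorph (quotientEquiv L hL).toHomeomorph,
    L.contDiff.comp_contDiffOn hΞs,
    hΞ.comp L.symm.contDiff.contDiffOn fun x hx ↦ hx,
    (quotientEquiv L hL).contDiff.comp_contDiffOn hξs,
    hξ.comp (quotientEquiv L hL).symm.contDiff.contDiffOn fun x hx ↦ hx, h0, hξN,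
    fun x ↦ Iff.rfl, fun x hx ↦ ?_⟩
  have hxt : x ∈ Ξ.target := hx
  have hys : Ξ.symm x ∈ Ξ.source := Ξ.map_target hxt
  have hyx : Ξ (Ξ.symm x) = x := Ξ.right_inv hxt
  have hd : ∀ v, fderiv ℝ (Ξ.symm.transHomeomorph L.toHomeomorph) x v =
      L (fderiv ℝ Ξ.symm x v) := fun v ↦ by
    have h1 := ((hΞs.contDiffAt (Ξ.open_target.mem_nhds hxt)).differentiableAt
      (by simp)).hasFDerivAt
    have h2 : HasFDerivAt (Ξ.symm.transHomeomorph L.toHomeomorph) _ x :=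
      (L : (F × ℝ) →L[ℝ] TotalCoord n).hasFDerivAt.comp x h1
    rw [h2.fderiv]
    rfl
  have hs : ∀ a, fderiv ℝ Ξ (Ξ.symm x) a =
      (fderiv ℝ ξ (Ξ.symm x).1 a.1, a.2 + fderiv ℝ f (Ξ.symm x).1 a.1) :=
    fun a ↦ fderiv_shear hξ hf hys a
  refine ⟨quotientEquiv_apply L hL (Ξ.symm x), ?_, fun a b ↦ ?_⟩
  · rw [hd]
    have h1 := fderiv_symm_comp_fderiv hΞ hΞs hys (0, 1)
    rw [hyx, hs] at h1
    simp only [map_zero, add_zero] at h1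
    rw [h1, hL]
  · have h1 : ∀ v, fderiv ℝ Ξ (Ξ.symm x) (fderiv ℝ Ξ.symm x v) = v := fun v ↦
      fderiv_symm_comp_fderiv (e := Ξ.symm) hΞs hΞ hxt v
    have h2 := hB _ hys (fderiv ℝ Ξ.symm x a) (fderiv ℝ Ξ.symm x b)
    rw [← hs, ← hs, h1, h1] at h2
    have h3 : ξ (Ξ.symm x).1 = x.1 := congrArg Prod.fst hyx
    rw [hd, hd, ← hLB, ← h2, h3]

end

/-! ### Coordinate representations of 2-forms -/

noncomputable section

section CoordinateSystems

variable {E : Type*} [NormedAddCommGroup E] [NormedSpace ℝ E]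
  {M : Type*} [TopologicalSpace M] [ChartedSpace E M]
  {G : Type*} [NormedAddCommGroup G] [NormedSpace ℝ G]
  {G' : Type*} [NormedAddCommGroup G'] [NormedSpace ℝ G']

namespace IsSmoothCoordinateSystem

variable {θ : OpenPartialHomeomorph M G}

lemma mdifferentiable (hθ : IsSmoothCoordinateSystem (E := E) θ) :
    θ.MDifferentiable 𝓘(ℝ, E) 𝓘(ℝ, G) :=
  ⟨hθ.1.mdifferentiableOn (by simp), hθ.2.mdifferentiableOn (by simp)⟩

lemma trans (hθ : IsSmoothCoordinateSystem (E := E) θ) {g : OpenPartialHomeomorph G G'}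
    (hg : ContDiffOn ℝ ∞ g g.source) (hgs : ContDiffOn ℝ ∞ g.symm g.target) :
    IsSmoothCoordinateSystem (E := E) (θ.trans g) := by
  refine ⟨?_, ?_⟩
  · refine (hg.contMDiffOn).comp (hθ.1.mono ?_) ?_
    · exact fun x hx ↦ hx.1
    · exact fun x hx ↦ hx.2
  · refine hθ.2.comp (hgs.contMDiffOn.mono ?_) ?_
    · exact fun x hx ↦ hx.1
    · exact fun x hx ↦ hx.2

lemma differential_trans (hθ : IsSmoothCoordinateSystem (E := E) θ)
    {g : OpenPartialHomeomorph G G'} (hg : ContDiffOn ℝ ∞ g g.source) {b : M}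
    (hb : b ∈ (θ.trans g).source) (v : TangentSpace 𝓘(ℝ, E) b) :
    differential (θ.trans g) b v = fderiv ℝ g (θ b) (differential θ b v) := by
  have h1 : MDifferentiableAt 𝓘(ℝ, G) 𝓘(ℝ, G') g (θ b) :=
    ((hg.contDiffAt (g.open_source.mem_nhds hb.2)).differentiableAt (by simp)).mdifferentiableAt
  have h2 := mfderiv_comp b h1 (hθ.mdifferentiable.mdifferentiableAt hb.1)
  rw [mfderiv_eq_fderiv] at h2
  exact DFunLike.congr_fun h2 v

lemma mfderiv_symm_differential (hθ : IsSmoothCoordinateSystem (E := E) θ) {b : M}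
    (hb : b ∈ θ.source) (v : TangentSpace 𝓘(ℝ, E) b) :
    mfderiv 𝓘(ℝ, G) 𝓘(ℝ, E) θ.symm (θ b) (differential θ b v) = v :=
  DFunLike.congr_fun (hθ.mdifferentiable.symm_comp_deriv hb) v

end IsSmoothCoordinateSystem

/-- A 2-form at a point of a vector space, as a bilinear map. -/
def formBilin (G : Type*) [NormedAddCommGroup G] [NormedSpace ℝ G] :
    (G [⋀^Fin 2]→L[ℝ] ℝ) →L[ℝ] G →L[ℝ] G →L[ℝ] ℝ :=
  (ContinuousLinearMap.compL ℝ G (G [⋀^Fin 1]→L[ℝ] ℝ) (G →L[ℝ] ℝ)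
    (ContinuousAlternatingMap.ofSubsingletonLIE (𝕜 := ℝ) (E := G) (F := ℝ)
      (0 : Fin 1)).symm.toContinuousLinearEquiv.toContinuousLinearMap).comp
    (ContinuousAlternatingMap.curryLeftLI (𝕜 := ℝ) (E := G) (F := ℝ)
      (n := 1)).toContinuousLinearMap

lemma formBilin_apply (η : G [⋀^Fin 2]→L[ℝ] ℝ) (a b : G) : formBilin G η a b = η ![a, b] := by
  change η (Matrix.vecCons a fun _ ↦ b) = _
  congr 1
  ext i
  fin_cases i <;> rfl

lemma contDiff_formBilin : ContDiff ℝ ∞ (formBilin G) :=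
  ContinuousLinearMap.contDiff (𝕜 := ℝ) (E := G [⋀^Fin 2]→L[ℝ] ℝ) (F := G →L[ℝ] G →L[ℝ] ℝ)
    (formBilin G)

/-- The representation of the 2-form `Ω` in the coordinate system `θ`. -/
def coordForm (Ω : TwoForm E M) (θ : OpenPartialHomeomorph M G) : G → G [⋀^Fin 2]→L[ℝ] ℝ :=
  Ω.pullback (F := G) (N := G) θ.symm

lemma coordForm_apply (Ω : TwoForm E M) (θ : OpenPartialHomeomorph M G) (x : G) (v : Fin 2 → G) :
    coordForm Ω θ x v = Ω (θ.symm x) fun i ↦ mfderiv 𝓘(ℝ, G) 𝓘(ℝ, E) θ.symm x (v i) := rfl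

/-- Substitution of equal base points in a 2-form, with the tangent vectors regarded as elements
of the model space `E`. -/
lemma form_congr (Ω : TwoForm E M) {b b' : M} (h : b = b') {v v' : Fin 2 → E}
    (hv : ∀ i, v i = v' i) :
    (Ω b : E [⋀^Fin 2]→L[ℝ] ℝ) v = (Ω b' : E [⋀^Fin 2]→L[ℝ] ℝ) v' := by
  rw [h, funext hv]

lemma form_eq_coordForm (Ω : TwoForm E M) {θ : OpenPartialHomeomorph M G}
    (hθ : IsSmoothCoordinateSystem (E := E) θ) {b : M} (hb : b ∈ θ.source)
    (v w : TangentSpace 𝓘(ℝ, E) b) :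
    Ω b ![v, w] = coordForm Ω θ (θ b) ![differential θ b v, differential θ b w] := by
  rw [coordForm_apply]
  refine form_congr Ω (θ.left_inv hb).symm fun i ↦ ?_
  fin_cases i
  · exact (hθ.mfderiv_symm_differential hb v).symm
  · exact (hθ.mfderiv_symm_differential hb w).symm

section Smooth

variable [IsManifold 𝓘(ℝ, E) ∞ M] {θ : OpenPartialHomeomorph M G}

lemma contDiffOn_transition (hθ : IsSmoothCoordinateSystem (E := E) θ)
    (m : M) : ContDiffOn ℝ ∞ (chartAt E m ∘ θ.symm)
      (θ.target ∩ θ.symm ⁻¹' (chartAt E m).source) := by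
  refine ContMDiffOn.contDiffOn ?_
  exact (contMDiffOn_chart (I := 𝓘(ℝ, E)) (x := m)).comp (hθ.2.mono inter_subset_left)
    fun x hx ↦ hx.2

/-- On the overlap with a chart, the representation of `Ω` in `θ` is the pullback of its
representation in the chart under the transition map. -/
lemma coordForm_eq_pullback (Ω : TwoForm E M) (hθ : IsSmoothCoordinateSystem (E := E) θ)
    {m : M} {y : G} (hy : y ∈ θ.target ∩ θ.symm ⁻¹' (chartAt E m).source) :
    coordForm Ω θ y =
      (Ω.inChart (chartAt E m) ((chartAt E m ∘ θ.symm) y)).compContinuousLinearMap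
        (fderiv ℝ (chartAt E m ∘ θ.symm) y) := by
  have he : (chartAt E m).MDifferentiable 𝓘(ℝ, E) 𝓘(ℝ, E) :=
    mdifferentiable_chart (I := 𝓘(ℝ, E)) m
  have h1 : fderiv ℝ (chartAt E m ∘ θ.symm) y =
      (mfderiv 𝓘(ℝ, E) 𝓘(ℝ, E) (chartAt E m) (θ.symm y)).comp
        (mfderiv 𝓘(ℝ, G) 𝓘(ℝ, E) θ.symm y) := by
    rw [← mfderiv_eq_fderiv]
    exact mfderiv_comp y (he.mdifferentiableAt hy.2)
      (hθ.mdifferentiable.mdifferentiableAt_symm hy.1)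
  ext v
  rw [h1]
  refine form_congr Ω ((chartAt E m).left_inv hy.2).symm fun i ↦ ?_
  exact (DFunLike.congr_fun (he.symm_comp_deriv hy.2)
    (mfderiv 𝓘(ℝ, G) 𝓘(ℝ, E) θ.symm y (v i))).symm

lemma isOpen_transition_domain (m : M) :
    IsOpen (θ.target ∩ θ.symm ⁻¹' (chartAt E m).source) :=
  θ.symm.continuousOn.isOpen_inter_preimage θ.open_target (chartAt E m).open_source

lemma mem_transition_domain {x : G} (hx : x ∈ θ.target) :
    x ∈ θ.target ∩ θ.symm ⁻¹' (chartAt E (θ.symm x)).source :=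
  ⟨hx, mem_chart_source E (θ.symm x)⟩

lemma coordForm_eventuallyEq (Ω : TwoForm E M) (hθ : IsSmoothCoordinateSystem (E := E) θ)
    {x : G} (hx : x ∈ θ.target) :
    coordForm Ω θ =ᶠ[nhds x] fun y ↦
      (Ω.inChart (chartAt E (θ.symm x)) ((chartAt E (θ.symm x) ∘ θ.symm) y)).compContinuousLinearMap
        (fderiv ℝ (chartAt E (θ.symm x) ∘ θ.symm) y) :=
  Filter.eventually_of_mem ((isOpen_transition_domain _).mem_nhds (mem_transition_domain hx))
    fun _ hy ↦ coordForm_eq_pullback Ω hθ hy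

lemma contDiffAt_transition (hθ : IsSmoothCoordinateSystem (E := E) θ) {x : G}
    (hx : x ∈ θ.target) : ContDiffAt ℝ ∞ (chartAt E (θ.symm x) ∘ θ.symm) x :=
  (contDiffOn_transition hθ _).contDiffAt
    ((isOpen_transition_domain _).mem_nhds (mem_transition_domain hx))

lemma transition_mem_target {x : G} :
    (chartAt E (θ.symm x) ∘ θ.symm) x ∈ (chartAt E (θ.symm x)).target :=
  (chartAt E (θ.symm x)).map_source (mem_chart_source E (θ.symm x))

lemma TwoForm.IsSmooth.contDiffAt_inChart {Ω : TwoForm E M} (hΩ : Ω.IsSmooth) {x : G} :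
    ContDiffAt ℝ ∞ (Ω.inChart (chartAt E (θ.symm x))) ((chartAt E (θ.symm x) ∘ θ.symm) x) :=
  (hΩ _ (chart_mem_atlas E _)).contDiffAt
    ((chartAt E (θ.symm x)).open_target.mem_nhds transition_mem_target)

lemma differentiableAt_coordForm {Ω : TwoForm E M} (hΩ : Ω.IsSmooth)
    (hθ : IsSmoothCoordinateSystem (E := E) θ) {x : G} (hx : x ∈ θ.target) :
    DifferentiableAt ℝ (coordForm Ω θ) x := by
  have h1 := contDiffAt_transition hθ hx
  have h2 : DifferentiableAt ℝ (Ω.inChart (chartAt E (θ.symm x)) ∘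
      (chartAt E (θ.symm x) ∘ θ.symm)) x :=
    (hΩ.contDiffAt_inChart.differentiableAt (by simp)).comp x (h1.differentiableAt (by simp))
  have h3 : DifferentiableAt ℝ (fderiv ℝ (chartAt E (θ.symm x) ∘ θ.symm)) x :=
    (h1.fderiv_right (m := 1) (by norm_cast)).differentiableAt (by simp)
  have h4 := h2.hasFDerivAt.continuousAlternatingMapCompContinuousLinearMap h3.hasFDerivAt
  exact (h4.congr_of_eventuallyEq (coordForm_eventuallyEq Ω hθ hx)).differentiableAt

lemma extDeriv_coordForm {Ω : TwoForm E M} (hΩ : Ω.IsSmooth) (hc : Ω.IsClosed)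
    (hθ : IsSmoothCoordinateSystem (E := E) θ) {x : G} (hx : x ∈ θ.target) :
    extDeriv (coordForm Ω θ) x = 0 := by
  rw [(coordForm_eventuallyEq Ω hθ hx).extDeriv_eq,
    extDeriv_pullback (r := ∞) (hΩ.contDiffAt_inChart.differentiableAt (by simp))
      (contDiffAt_transition hθ hx)
      (by rw [minSmoothness_of_isRCLikeNormedField]; exact ENat.LEInfty.out),
    hc _ (chart_mem_atlas E _) _ transition_mem_target]
  ext v
  rfl

lemma contDiffOn_formBilin_coordForm [FiniteDimensional ℝ G] {Ω : TwoForm E M} (hΩ : Ω.IsSmooth)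
    (hθ : IsSmoothCoordinateSystem (E := E) θ) :
    ContDiffOn ℝ ∞ (fun x ↦ formBilin G (coordForm Ω θ x)) θ.target := by
  refine contDiffOn_clm_apply.2 fun a ↦ contDiffOn_clm_apply.2 fun b ↦ fun x hx ↦ ?_
  refine ContDiffAt.contDiffWithinAt ?_
  have h1 := contDiffAt_transition hθ hx
  have h2 : ContDiffAt ℝ ∞ (fderiv ℝ (chartAt E (θ.symm x) ∘ θ.symm)) x :=
    h1.fderiv_right (by norm_cast)
  have h3 : ContDiffAt ℝ ∞ (fun y ↦ formBilin E (Ω.inChart (chartAt E (θ.symm x))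
      ((chartAt E (θ.symm x) ∘ θ.symm) y))) x :=
    (contDiff_formBilin (G := E)).contDiffAt.comp x (hΩ.contDiffAt_inChart.comp x h1)
  have h4 := (h3.clm_apply (h2.clm_apply (contDiffAt_const (c := a)))).clm_apply
    (h2.clm_apply (contDiffAt_const (c := b)))
  refine h4.congr_of_eventuallyEq ?_
  filter_upwards [coordForm_eventuallyEq Ω hθ hx] with y hy
  rw [hy, formBilin_apply, formBilin_apply, ContinuousAlternatingMap.compContinuousLinearMap_apply]
  congr 1
  ext i
  fin_cases i <;> rfl

end Smooth

end CoordinateSystems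

end

/-! ### Bundle charts -/

noncomputable section

section BundleChart

variable {E : Type*} [NormedAddCommGroup E] [NormedSpace ℝ E]
  {A : Type*} [TopologicalSpace A] [ChartedSpace E A]
  {F : Type*} [NormedAddCommGroup F] [NormedSpace ℝ F]
  {V : Type*} [TopologicalSpace V] [ChartedSpace F V]

/-- Coordinates `κ` on the base and `θ` on the total space of a principal `ℝ`-bundle in which the
projection is `(w, r) ↦ w` and the action is by translations of `r`. The domain of `θ` is
saturated: it is a union of fibres. -/
structure IsBundleChart (μ : A → V) (ψ : ℝ → A → A) (κ : OpenPartialHomeomorph V F)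
    (θ : OpenPartialHomeomorph A (F × ℝ)) : Prop where
  smooth_base : IsSmoothCoordinateSystem (E := F) κ
  smooth_total : IsSmoothCoordinateSystem (E := E) θ
  proj : ∀ b ∈ θ.source, μ b ∈ κ.source ∧ κ (μ b) = (θ b).1
  act : ∀ b ∈ θ.source, ∀ s, ψ s b ∈ θ.source ∧ θ (ψ s b) = ((θ b).1, s + (θ b).2)
  target : ∀ x, x ∈ θ.target ↔ (x.1, (0 : ℝ)) ∈ θ.target

/-- A chart centred at `v`. -/
lemma exists_centred_chart [IsManifold 𝓘(ℝ, F) ∞ V] (v : V) : ∃ κ : OpenPartialHomeomorph V F,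
    IsSmoothCoordinateSystem (E := F) κ ∧ v ∈ κ.source ∧ κ v = 0 := by
  let c := chartAt F v v
  refine ⟨(chartAt F v).transHomeomorph (Homeomorph.addRight (-c)), ⟨?_, ?_⟩,
    mem_chart_source F v, add_neg_cancel c⟩
  · have h : ContDiff ℝ ∞ fun w : F ↦ w + -c := contDiff_id.add contDiff_const
    exact h.contMDiff.comp_contMDiffOn (contMDiffOn_chart (I := 𝓘(ℝ, F)) (x := v))
  · have h : ContDiff ℝ ∞ fun w : F ↦ w + - -c := contDiff_id.add contDiff_const
    exact (contMDiffOn_chart_symm (I := 𝓘(ℝ, F)) (x := v)).comp h.contMDiff.contMDiffOn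
      fun x hx ↦ hx

theorem exists_isBundleChart [IsManifold 𝓘(ℝ, F) ∞ V] {μ : A → V} {ψ : ℝ → A → A}
    (hμ : IsPrincipalRBundle E F μ ψ) (a : A) :
    ∃ (κ : OpenPartialHomeomorph V F) (θ : OpenPartialHomeomorph A (F × ℝ)),
      IsBundleChart (E := E) μ ψ κ θ ∧ a ∈ θ.source ∧ κ (μ a) = 0 := by
  obtain ⟨κ, hκ, haκ, hκ0⟩ := exists_centred_chart (F := F) (μ a)
  obtain ⟨T, haT, ⟨hT, hTs⟩, hTψ⟩ := hμ.locally_trivial (μ a)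
  let θ : OpenPartialHomeomorph A (F × ℝ) :=
    T.toOpenPartialHomeomorph.trans (κ.prod (OpenPartialHomeomorph.refl ℝ))
  have hfst : ∀ b ∈ T.source, (T b).1 = μ b := fun b hb ↦ T.coe_fst hb
  have hsrc : ∀ b, b ∈ θ.source ↔ b ∈ T.source ∧ μ b ∈ κ.source := by
    intro b
    constructor
    · rintro ⟨hb, hb'⟩
      refine ⟨hb, ?_⟩
      rw [← hfst b hb]
      exact hb'.1
    · rintro ⟨hb, hb'⟩
      refine ⟨hb, ?_, mem_univ _⟩
      rw [← hfst b hb] at hb'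
      exact hb'
  have hval : ∀ b, θ b = (κ (T b).1, (T b).2) := fun b ↦ rfl
  have hsat : ∀ b ∈ T.source, ∀ s, ψ s b ∈ T.source := fun b hb s ↦ by
    rw [T.mem_source] at hb ⊢
    rwa [hμ.proj_act]
  have hsymm : ∀ x, θ.symm x = T.toOpenPartialHomeomorph.symm (κ.symm x.1, x.2) := fun x ↦ rfl
  have htgt : ∀ x, x ∈ θ.target ↔ x.1 ∈ κ.target ∧ κ.symm x.1 ∈ T.baseSet := by
    intro x
    have : x ∈ θ.target ↔ (x.1 ∈ κ.target ∧ x.2 ∈ univ) ∧ (κ.symm x.1, x.2) ∈ T.target := Iff.rfl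
    rw [this, T.mem_target]
    simp
  refine ⟨κ, θ, ⟨hκ, ⟨?_, ?_⟩, fun b hb ↦ ?_, fun b hb s ↦ ?_, fun x ↦ ?_⟩, ?_, hκ0⟩
  · have h1 : ContMDiffOn 𝓘(ℝ, E) 𝓘(ℝ, F) ∞ (fun b ↦ κ (μ b)) θ.source :=
      hκ.1.comp hμ.smooth_proj.contMDiffOn fun b hb ↦ ((hsrc b).1 hb).2
    have h2 : ContMDiffOn 𝓘(ℝ, E) 𝓘(ℝ, ℝ) ∞ (fun b ↦ (T b).2) θ.source :=
      contMDiff_snd.comp_contMDiffOn (hT.mono fun b hb ↦ ((hsrc b).1 hb).1)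
    refine (h1.prodMk_space h2).congr fun b hb ↦ ?_
    rw [hval, hfst b ((hsrc b).1 hb).1]
  · have h1 : ContMDiffOn 𝓘(ℝ, F × ℝ) 𝓘(ℝ, F) ∞ (fun x : F × ℝ ↦ κ.symm x.1) θ.target :=
      hκ.2.comp contDiff_fst.contMDiff.contMDiffOn fun x hx ↦ ((htgt x).1 hx).1
    have h2 : ContMDiffOn 𝓘(ℝ, F × ℝ) 𝓘(ℝ, ℝ) ∞ (fun x : F × ℝ ↦ x.2) θ.target :=
      contDiff_snd.contMDiff.contMDiffOn
    exact hTs.comp (h1.prodMk h2) fun x hx ↦ T.mem_target.2 ((htgt x).1 hx).2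
  · obtain ⟨h1, h2⟩ := (hsrc b).1 hb
    exact ⟨h2, by rw [hval, hfst b h1]⟩
  · obtain ⟨h1, h2⟩ := (hsrc b).1 hb
    refine ⟨(hsrc _).2 ⟨hsat b h1 s, by rwa [hμ.proj_act]⟩, ?_⟩
    rw [hval, hval, hTψ b h1 s]
  · rw [htgt, htgt]
  · exact (hsrc a).2 ⟨T.mem_source.2 haT, haκ⟩

variable {μ : A → V} {ψ : ℝ → A → A} {κ : OpenPartialHomeomorph V F}
  {θ : OpenPartialHomeomorph A (F × ℝ)}

namespace IsBundleChart

lemma symm_translate (h : IsBundleChart (E := E) μ ψ κ θ) {x : F × ℝ} (hx : x ∈ θ.target) (s : ℝ) :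
    (x.1, s + x.2) ∈ θ.target ∧ θ.symm (x.1, s + x.2) = ψ s (θ.symm x) := by
  have h1 := h.act _ (θ.map_target hx) s
  rw [θ.right_inv hx] at h1
  refine ⟨?_, ?_⟩
  · rw [← h1.2]
    exact θ.map_source h1.1
  · rw [← h1.2, θ.left_inv h1.1]

lemma differential_infinitesimalGenerator (h : IsBundleChart (E := E) μ ψ κ θ)
    (hψ : IsPrincipalRBundle E F μ ψ) {b : A} (hb : b ∈ θ.source) :
    differential θ b (infinitesimalGenerator E ψ b) = ((0 : F), (1 : ℝ)) := by
  have h1 : MDifferentiableAt 𝓘(ℝ, ℝ) 𝓘(ℝ, E) (fun s : ℝ ↦ ψ s b) 0 := by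
    have h2 : ContMDiff 𝓘(ℝ, ℝ) 𝓘(ℝ, E) ∞ (fun s : ℝ ↦ ψ s b) :=
      hψ.smooth_act.comp (contMDiff_id.prodMk contMDiff_const)
    exact h2.mdifferentiableAt (by simp)
  have h0 : ψ 0 b = b := hψ.zero_act b
  have h2 : MDifferentiableAt 𝓘(ℝ, E) 𝓘(ℝ, F × ℝ) θ (ψ 0 b) := by
    rw [h0]
    exact h.smooth_total.mdifferentiable.mdifferentiableAt hb
  have h3 : mfderiv 𝓘(ℝ, ℝ) 𝓘(ℝ, F × ℝ) (θ ∘ fun s : ℝ ↦ ψ s b) 0 =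
      (mfderiv 𝓘(ℝ, E) 𝓘(ℝ, F × ℝ) θ (ψ 0 b)).comp
        (mfderiv 𝓘(ℝ, ℝ) 𝓘(ℝ, E) (fun s : ℝ ↦ ψ s b) 0) :=
    mfderiv_comp 0 h2 h1
  have h4 : (θ ∘ fun s : ℝ ↦ ψ s b) = fun s ↦ ((θ b).1, s + (θ b).2) :=
    funext fun s ↦ (h.act b hb s).2
  have h5 : HasFDerivAt (fun s : ℝ ↦ ((θ b).1, s + (θ b).2))
      (ContinuousLinearMap.inr ℝ F ℝ) 0 :=
    (hasFDerivAt_const (θ b).1 (0 : ℝ)).prodMk ((hasFDerivAt_id (0 : ℝ)).add_const _)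
  rw [h4, mfderiv_eq_fderiv, h5.fderiv, h0] at h3
  exact (DFunLike.congr_fun h3 (1 : ℝ)).symm

/-- In a bundle chart an invariant form is invariant under translations. -/
lemma coordForm_translate (h : IsBundleChart (E := E) μ ψ κ θ)
    (hψ : IsPrincipalRBundle E F μ ψ) {Ω : TwoForm E A} (hΩ : ∀ s : ℝ, Ω.pullback (ψ s) = Ω)
    {x : F × ℝ} (hx : x ∈ θ.target) (s : ℝ) :
    coordForm Ω θ (x.1, s + x.2) = coordForm Ω θ x := by
  obtain ⟨hxs, hxψ⟩ := h.symm_translate hx s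
  let τ : F × ℝ → F × ℝ := fun y ↦ (y.1, s + y.2)
  have hτ : HasFDerivAt τ (ContinuousLinearMap.id ℝ (F × ℝ)) x :=
    (hasFDerivAt_fst (𝕜 := ℝ) (E := F) (F := ℝ) (p := x)).prodMk (hasFDerivAt_snd.const_add s)
  have hθ := h.smooth_total.mdifferentiable
  have h1 : mfderiv 𝓘(ℝ, F × ℝ) 𝓘(ℝ, E) (θ.symm ∘ τ) x =
      (mfderiv 𝓘(ℝ, F × ℝ) 𝓘(ℝ, E) θ.symm (x.1, s + x.2)).comp
        (mfderiv 𝓘(ℝ, F × ℝ) 𝓘(ℝ, F × ℝ) τ x) :=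
    mfderiv_comp x (hθ.mdifferentiableAt_symm hxs) hτ.differentiableAt.mdifferentiableAt
  have hψs : ContMDiff 𝓘(ℝ, E) 𝓘(ℝ, E) ∞ (ψ s) :=
    hψ.smooth_act.comp (contMDiff_const.prodMk contMDiff_id)
  have h2 : mfderiv 𝓘(ℝ, F × ℝ) 𝓘(ℝ, E) (ψ s ∘ θ.symm) x =
      (mfderiv 𝓘(ℝ, E) 𝓘(ℝ, E) (ψ s) (θ.symm x)).comp
        (mfderiv 𝓘(ℝ, F × ℝ) 𝓘(ℝ, E) θ.symm x) :=
    mfderiv_comp x (hψs.mdifferentiableAt (by simp)) (hθ.mdifferentiableAt_symm hx)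
  have h3 : (θ.symm ∘ τ) =ᶠ[nhds x] (ψ s ∘ θ.symm) :=
    Filter.eventually_of_mem (θ.open_target.mem_nhds hx) fun y hy ↦ (h.symm_translate hy s).2
  ext v
  have h4 : coordForm Ω θ x v = (Ω.pullback (ψ s) (θ.symm x) : E [⋀^Fin 2]→L[ℝ] ℝ)
      fun i ↦ mfderiv 𝓘(ℝ, F × ℝ) 𝓘(ℝ, E) θ.symm x (v i) := by
    rw [hΩ s]
    rfl
  rw [h4]
  refine form_congr Ω hxψ fun i ↦ ?_
  have h5 : mfderiv 𝓘(ℝ, F × ℝ) 𝓘(ℝ, E) (θ.symm ∘ τ) x (v i) =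
      mfderiv 𝓘(ℝ, F × ℝ) 𝓘(ℝ, E) (ψ s ∘ θ.symm) x (v i) :=
    DFunLike.congr_fun (h3.mfderiv_eq (I := 𝓘(ℝ, F × ℝ)) (I' := 𝓘(ℝ, E))) (v i)
  rw [h1, h2, mfderiv_eq_fderiv, hτ.fderiv] at h5
  exact h5

/-- The representation of an invariant form is determined on the slice of height `0`. -/
lemma coordForm_eq_slice (h : IsBundleChart (E := E) μ ψ κ θ)
    (hψ : IsPrincipalRBundle E F μ ψ) {Ω : TwoForm E A} (hΩ : ∀ s : ℝ, Ω.pullback (ψ s) = Ω)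
    {x : F × ℝ} (hx : x ∈ θ.target) : coordForm Ω θ x = coordForm Ω θ (x.1, 0) := by
  have := h.coordForm_translate hψ hΩ hx (-x.2)
  rw [← this, neg_add_cancel]

/-- The values of `Ω` along the slice of height `0` of a bundle chart form a closed invariant
form. -/
lemma isClosedInvariantForm [IsManifold 𝓘(ℝ, E) ∞ A] {F : Type*} [NormedAddCommGroup F]
    [NormedSpace ℝ F] [FiniteDimensional ℝ F] [ChartedSpace F V] {κ : OpenPartialHomeomorph V F}
    {θ : OpenPartialHomeomorph A (F × ℝ)} (h : IsBundleChart (E := E) μ ψ κ θ)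
    {Ω : TwoForm E A} (hΩ : IsSymplecticPrincipalRBundle F μ ψ Ω) :
    IsClosedInvariantForm (fun w ↦ formBilin (F × ℝ) (coordForm Ω θ (w, 0)))
      {w | (w, (0 : ℝ)) ∈ θ.target} := by
  have hθ := h.smooth_total
  have hsm := hΩ.symplectic.smooth
  have hsmooth : ContDiffOn ℝ ∞ (fun w ↦ formBilin (F × ℝ) (coordForm Ω θ (w, 0)))
      {w | (w, (0 : ℝ)) ∈ θ.target} :=
    (contDiffOn_formBilin_coordForm hsm hθ).comp
      (contDiff_id.prodMk contDiff_const).contDiffOn fun w hw ↦ hw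
  refine ⟨hsmooth, fun w _ v ↦ ?_, fun w hw a b c ↦ ?_⟩
  · rw [formBilin_apply]
    exact (coordForm Ω θ (w, 0)).map_eq_zero_of_eq ![v, v] (i := 0) (j := 1) rfl (by simp)
  · have hopen : IsOpen {w : F | (w, (0 : ℝ)) ∈ θ.target} :=
      θ.open_target.preimage (Continuous.prodMk_left 0)
    have hd := ((hsmooth.contDiffAt (hopen.mem_nhds hw)).differentiableAt (by simp)).hasFDerivAt
    have key : ∀ u v v' : F × ℝ, fderiv ℝ (fun y ↦ coordForm Ω θ y ![v, v']) (w, 0) u =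
        fderiv ℝ (fun w ↦ formBilin (F × ℝ) (coordForm Ω θ (w, 0))) w u.1 v v' := by
      intro u v v'
      have h1 := ((HasFDerivAt.comp (f := Prod.fst) ((w, 0) : F × ℝ) hd hasFDerivAt_fst).clm_apply
        (hasFDerivAt_const v _)).clm_apply (hasFDerivAt_const v' _)
      have h2 : (fun y ↦ coordForm Ω θ y ![v, v']) =ᶠ[nhds ((w, 0) : F × ℝ)]
          fun y ↦ formBilin (F × ℝ) (coordForm Ω θ (y.1, 0)) v v' := by
        filter_upwards [θ.open_target.mem_nhds hw] with y hy
        rw [formBilin_apply, ← h.coordForm_eq_slice hΩ.principal hΩ.invariant hy]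
      rw [(h1.congr_of_eventuallyEq h2).fderiv]
      simp
    have h3 := extDeriv_apply (differentiableAt_coordForm hsm hθ hw) ![a, b, c]
    rw [extDeriv_coordForm hsm hΩ.symplectic.closed hθ hw] at h3
    have r0 : (0 : Fin 3).removeNth ![a, b, c] = ![b, c] := by
      ext i <;> fin_cases i <;> rfl
    have r1 : (1 : Fin 3).removeNth ![a, b, c] = ![a, c] := by
      ext i <;> fin_cases i <;> rfl
    have r2 : (2 : Fin 3).removeNth ![a, b, c] = ![a, b] := by
      ext i <;> fin_cases i <;> rfl
    rw [Fin.sum_univ_three, r0, r1, r2] at h3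
    have h4 : (0 : ℝ) = fderiv ℝ (fun y ↦ coordForm Ω θ y ![b, c]) (w, 0) a -
        fderiv ℝ (fun y ↦ coordForm Ω θ y ![a, c]) (w, 0) b +
        fderiv ℝ (fun y ↦ coordForm Ω θ y ![a, b]) (w, 0) c := by
      simpa [sub_eq_add_neg] using h3
    rw [key, key, key] at h4
    exact h4.symm

end IsBundleChart

/-- The coordinate representation of a nondegenerate form is nondegenerate. -/
lemma coordForm_nondegenerate {G : Type*} [NormedAddCommGroup G] [NormedSpace ℝ G]
    {θ : OpenPartialHomeomorph A G} {Ω : TwoForm E A} (hΩ : Ω.IsNondegenerate)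
    (hθ : IsSmoothCoordinateSystem (E := E) θ) {b : A} (hb : b ∈ θ.source) {v : G}
    (hv : ∀ w, coordForm Ω θ (θ b) ![v, w] = 0) : v = 0 := by
  have hs : Function.Surjective (differential (E := E) θ b) :=
    hθ.mdifferentiable.mfderiv_surjective hb
  obtain ⟨v', rfl⟩ := hs v
  have : v' = 0 := hΩ b v' fun w ↦ by
    rw [form_eq_coordForm Ω hθ hb]
    exact hv _
  rw [this, map_zero]

end BundleChart

end

end SymplecticRBundle

/-! ### Darboux coordinates on a symplectic principal `ℝ`-bundle -/

theorem theorem3p3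
    {E : Type*} [NormedAddCommGroup E] [NormedSpace ℝ E] [FiniteDimensional ℝ E]
    {A : Type*} [TopologicalSpace A] [ChartedSpace E A] [IsManifold 𝓘(ℝ, E) ∞ A]
    {F : Type*} [NormedAddCommGroup F] [NormedSpace ℝ F] [FiniteDimensional ℝ F]
    {V : Type*} [TopologicalSpace V] [ChartedSpace F V] [IsManifold 𝓘(ℝ, F) ∞ V]
    (μ : A → V) (ψ : ℝ → A → A) (Ω : SymplecticRBundle.TwoForm E A)
    (hμ : SymplecticRBundle.IsSymplecticPrincipalRBundle F μ ψ Ω)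
    (n : ℕ) (hdim : Module.finrank ℝ E = 2 * n + 2) (a : A) :
    ∃ (φ : OpenPartialHomeomorph A (SymplecticRBundle.TotalCoord n))
      (χ : OpenPartialHomeomorph V (SymplecticRBundle.BaseCoord n)),
      -- coordinates `φ = (t, p, q, p_i)` around `a` and `χ = (t, q, p_i)` around `μ a`
      a ∈ φ.source ∧ SymplecticRBundle.IsSmoothCoordinateSystem (E := E) φ ∧
      μ a ∈ χ.source ∧ SymplecticRBundle.IsSmoothCoordinateSystem (E := F) χ ∧
      -- the local expression of `μ`
      (∀ b ∈ φ.source, μ b ∈ χ.source ∧ χ (μ b) = SymplecticRBundle.coordProj (φ b)) ∧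
      -- Darboux coordinates
      SymplecticRBundle.IsDarboux Ω φ ∧
      -- `Z_μ = ∂/∂p`
      (∀ b ∈ φ.source,
        SymplecticRBundle.differential φ b (SymplecticRBundle.infinitesimalGenerator E ψ b) =
          (0, 1, 0, 0)) := by
  obtain ⟨κ, θ, hchart, haθ, hκ0⟩ := SymplecticRBundle.exists_isBundleChart hμ.principal a
  have hθ := hchart.smooth_total
  have hform := hchart.isClosedInvariantForm hμ
  have haθ0 : (θ a).1 = 0 := by rw [← (hchart.proj a haθ).2, hκ0]
  have h0 : ((0 : F), (0 : ℝ)) ∈ θ.target := by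
    have := (hchart.target _).1 (θ.map_source haθ)
    rwa [haθ0] at this
  have hslice : ∀ x ∈ θ.target, ∀ v w : F × ℝ,
      SymplecticRBundle.coordForm Ω θ x ![v, w] =
        SymplecticRBundle.formBilin (F × ℝ) (SymplecticRBundle.coordForm Ω θ (x.1, 0)) v w := by
    intro x hx v w
    rw [SymplecticRBundle.formBilin_apply,
      ← hchart.coordForm_eq_slice hμ.principal hμ.invariant hx]
  have hN : {w : F | (w, (0 : ℝ)) ∈ θ.target} ∈ nhds (0 : F) :=
    (θ.open_target.preimage (Continuous.prodMk_left 0)).mem_nhds h0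
  -- The point `a` lies at height `(θ a).2` over `0`, in general not on the slice of height `0`;
  -- nondegeneracy is carried along the fibre by invariance.
  have hnd : ∀ v, (∀ w, SymplecticRBundle.formBilin (F × ℝ)
      (SymplecticRBundle.coordForm Ω θ (0, 0)) v w = 0) → v = 0 := by
    intro v hv
    refine SymplecticRBundle.coordForm_nondegenerate hμ.symplectic.nondegenerate hθ haθ fun w ↦ ?_
    rw [hslice _ (θ.map_source haθ), haθ0]
    exact hv w
  have hdimG : Module.finrank ℝ (F × ℝ) = 2 * n + 2 := by
    rw [← hdim]
    exact (LinearEquiv.finrank_eq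
      (hθ.mdifferentiable.mfderiv haθ : E ≃L[ℝ] F × ℝ).toLinearEquiv).symm
  obtain ⟨g, χ, hg, hgs, hχ, hχs, h0χ, -, hsrc, hgχ⟩ :=
    SymplecticRBundle.exists_adapted_darboux hN hform hnd hdimG
  refine ⟨θ.trans g, κ.trans χ, ⟨haθ, ?_⟩, hθ.trans hg hgs, ⟨(hchart.proj a haθ).1, ?_⟩,
    hchart.smooth_base.trans hχ hχs, fun b hb ↦ ⟨⟨(hchart.proj b hb.1).1, ?_⟩, ?_⟩,
    fun b hb v w ↦ ?_, fun b hb ↦ ?_⟩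
  · refine (hsrc _).2 ?_
    change (θ a).1 ∈ χ.source
    rwa [haθ0]
  · change κ (μ a) ∈ χ.source
    rwa [hκ0]
  · change κ (μ b) ∈ χ.source
    rw [(hchart.proj b hb.1).2]
    exact (hsrc _).1 hb.2
  · change χ (κ (μ b)) = SymplecticRBundle.coordProj (g (θ b))
    rw [(hchart.proj b hb.1).2]
    exact (hgχ _ hb.2).1
  · rw [hθ.differential_trans hg hb, hθ.differential_trans hg hb, ← (hgχ (θ b) hb.2).2.2,
      ← hslice _ (θ.map_source hb.1)]
    exact SymplecticRBundle.form_eq_coordForm Ω hθ hb.1 v w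
  · rw [hθ.differential_trans hg hb,
      hchart.differential_infinitesimalGenerator hμ.principal hb.1]
    exact (hgχ _ hb.2).2.1
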